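/- **Setting.** For $f_0=(f_{0,k})_{k\ge1}\in\ell_2$ let $\mathbb P_{f_0}$ be the law of $Y=(Y_k)_{k\ge1}$, $Y_k=f_{0,k}+n^{-1/2}Z_k$, with $Z_k$ i.i.d. $N(0,1)$. Let $\mathcal Q(\beta,R)=\{f\in\ell_2:\sup_{k\ge1}k^{2\beta+1}f_k^2\le R\}$. For $s\in\mathbb R$, $\delta\ge 0$ put $\|f\|_{H^{s,\delta}}^2=\sum_{k\ge1}k^{2s}(\log (k\vee2))^{-2\delta}f_k^2$, $\|\cdot\|_{H^s}=\|\cdot\|_{H^{s,0}}$ and $\|\cdot\|_{H(\delta)}=\|\cdot\|_{H^{-1/2,\delta}}$. For the prior $\bigotimes_k N(0,k^{-2\alpha-1})$ the posterior is $$\Pi_\alpha(\cdot\mid Y)=\bigotimes_{k=1}^\infty N\Big(\frac{n}{k^{2\alpha+1}+n}Y_k,\ \frac1{k^{2\alpha+1}+n}\Big).$$ Let $a_n\to\infty$ with $a_n=o(\log n)$ and let $\hat\alpha_n$ be any maximizer over $\alpha\in[0,a_n]$ of $$\ell_n(\alpha)=-\frac12\sum_{k=1}^\infty\Big(\log\Big(1+\frac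 n{k^{2\alpha+1}}\Big)-\frac{n^2}{k^{2\alpha+1}+n}Y_k^2\Big)$$ (the series being the limit of its partial sums). The empirical Bayes posterior is $\Pi_{\hat\alpha_n}(\cdot\mid Y)$, with mean $\hat f_n$, $\hat f_{n,k}=\frac{n}{k^{2\hat\alpha_n+1}+n}Y_k$. Let $\beta,R>0$, $\gamma\in(0,1)$, $\delta>1/2$, $r_1>0$, $C>0$ with $C^2>1/(2r_1)$. Consider $$\tilde C_n=\Big\{f:\ \|f-\hat f_n\|_{H(\delta)}\le \frac{R_n}{\sqrt n},\quad \|f-\hat f_n\|_{H^{\hat\alpha_n-\epsilon_n}}\le C\sqrt{\log n}\Big\},\qquad C_n^{\ell_2}=\{f:\|f-\hat f_n\|_2\le \tilde Q_n\},$$ where $\epsilon_n$ is any (possibly data-dependent) choice with $r_1/\log n\le\epsilon_n\le\hat\alpha_n/2$, $R_n\geq 0$ is such that $\Pi_{\hat\alpha_n}(f:\|f-\hat f_n\|_{H(\delta)}\le R_n/\sqrt n\mid Y)=1-\gamma$, and $\tilde Q_n\ge0$ is such that $\Pi_{\hat\alpha_n}(C_n^{\ell_2}\mid Y)=1-\gamma$.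 Each of $\hat\alpha_n,\epsilon_n,R_n,\tilde Q_n$ is a function of $(n,Y)$ that satisfies its requirement whenever this can be satisfied, and is arbitrary otherwise. **Theorem.** As $n\to\infty$, $$\Pi_{\hat\alpha_n}(\tilde C_n\cap C_n^{\ell_2}\mid Y)=\Pi_{\hat\alpha_n}(\tilde C_n\mid Y)\,\Pi_{\hat\alpha_n}(C_n^{\ell_2}\mid Y)+o_{\mathbb P}(1)=(1-\gamma)^2+o_{\mathbb P}(1)$$ uniformly over $f_0\in\mathcal Q(\beta,R)$, where $X_n=o_{\mathbb P}(1)$ uniformly means that $\sup_{f_0\in\mathcal Q(\beta,R)}\mathbb P_{f_0}(|X_n|\ge\eta)\to0$ for every $\eta>0$ (outer probability if $X_n$ is not measurable). -/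

import Mathlib

open MeasureTheory ProbabilityTheory Filter Topology Set Asymptotics
open scoped NNReal ENNReal

/-! Real sequences `(f_k)_{k ≥ 1}` are functions `f : ℕ → ℝ`; the Lean index `k : ℕ` stands for
the mathematical index `k + 1`. -/

noncomputable section

namespace SeqModel

/-- The (`[0, ∞]`-valued) norm of the logarithmic Sobolev space `H^{s,δ}`,
`‖f‖² = ∑_{k ≥ 1} k^{2s} (log (max k 2))^{-2δ} f_k²`. -/
def sobolevLogNorm (s δ : ℝ) (f : ℕ → ℝ) : ℝ≥0∞ :=
  (∑' k : ℕ, ENNReal.ofReal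
    (((k : ℝ) + 1) ^ (2 * s) * Real.log (max ((k : ℝ) + 1) 2) ^ (-2 * δ) * f k ^ 2))
      ^ (1 / 2 : ℝ)

/-- The norm of `H(δ) = H^{-1/2,δ}`. -/
def hNorm (δ : ℝ) (f : ℕ → ℝ) : ℝ≥0∞ := sobolevLogNorm (-1 / 2) δ f

/-- The norm of the Sobolev space `H^s = H^{s,0}`. -/
def sobolevNorm (s : ℝ) (f : ℕ → ℝ) : ℝ≥0∞ := sobolevLogNorm s 0 f

/-- The `ℓ₂` norm (`∞` if the sequence is not square summable). -/
def l2Norm (f : ℕ → ℝ) : ℝ≥0∞ := (∑' k : ℕ, ENNReal.ofReal (f k ^ 2)) ^ (1 / 2 : ℝ)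

/-- The Sobolev hyper-rectangle `Q(β, R) = {f ∈ ℓ₂ : sup_{k ≥ 1} k^{2β+1} f_k² ≤ R}`. -/
def hyperRectangle (β R : ℝ) : Set (ℕ → ℝ) :=
  {f | Summable (fun k => f k ^ 2) ∧ ∀ k : ℕ, ((k : ℝ) + 1) ^ (2 * β + 1) * f k ^ 2 ≤ R}

/-- The law of the data `Y_k = f_k + n^{-1/2} Z_k`, with `Z_k` i.i.d. standard normal. -/
def dataLaw (n : ℕ) (f₀ : ℕ → ℝ) : Measure (ℕ → ℝ) :=
  Measure.infinitePi (fun k => gaussianReal (f₀ k) (n : ℝ≥0)⁻¹)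

/-- The mean of the posterior with smoothness `α`, `f̂_k = n / (k^{2α+1} + n) · Y_k`. -/
def posteriorMean (n : ℕ) (α : ℝ) (y : ℕ → ℝ) (k : ℕ) : ℝ :=
  n / (((k : ℝ) + 1) ^ (2 * α + 1) + n) * y k

/-- The posterior for the prior `⨂_k N(0, k^{-2α-1})` given the data `y`:
`⨂_k N(n / (k^{2α+1} + n) · y_k, 1 / (k^{2α+1} + n))`. -/
def posterior (n : ℕ) (α : ℝ) (y : ℕ → ℝ) : Measure (ℕ → ℝ) :=
  Measure.infinitePi (fun k => gaussianReal (posteriorMean n α y k)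
    (1 / (((k : ℝ) + 1) ^ (2 * α + 1) + n)).toNNReal)

/-- `posteriorMean` is the mean of `posterior`. -/
theorem integral_posterior (n : ℕ) (α : ℝ) (y : ℕ → ℝ) (k : ℕ) :
    ∫ f, f k ∂(posterior n α y) = posteriorMean n α y k := by
  have h := (measurePreserving_eval_infinitePi (fun k => gaussianReal (posteriorMean n α y k)
    (1 / (((k : ℝ) + 1) ^ (2 * α + 1) + n)).toNNReal) k)
  have h2 := integral_map (μ := posterior n α y) (φ := fun f : ℕ → ℝ => f k)
    (f := fun x : ℝ => x) (measurable_pi_apply k).aemeasurable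
    aestronglyMeasurable_id
  rw [← h2]
  have h3 : Measure.map (fun f : ℕ → ℝ => f k) (posterior n α y) = _ := h.map_eq
  rw [h3]
  exact integral_id_gaussianReal

/-- The marginal log-likelihood
`ℓ_n(α) = -1/2 ∑_{k ≥ 1} (log (1 + n / k^{2α+1}) - n² / (k^{2α+1} + n) · Y_k²)`.
The series is the limit of its partial sums, since for `α = 0` it does not converge absolutely. -/
def logLikelihood (n : ℕ) (y : ℕ → ℝ) (α : ℝ) : ℝ :=
  -(1 / 2) * limUnder atTop (fun N : ℕ => ∑ k ∈ Finset.range N,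
    (Real.log (1 + n / ((k : ℝ) + 1) ^ (2 * α + 1))
      - (n : ℝ) ^ 2 / (((k : ℝ) + 1) ^ (2 * α + 1) + n) * y k ^ 2))

/-- The maximizers of the marginal log-likelihood over `[0, a]`. -/
def maximizers (n : ℕ) (a : ℝ) (y : ℕ → ℝ) : Set ℝ :=
  {α | α ∈ Icc 0 a ∧ IsMaxOn (logLikelihood n y) (Icc 0 a) α}

/-- The ball `{f : ‖f - f̂‖_{H(δ)} ≤ ρ / √n}` around the posterior mean. -/
def hBall (n : ℕ) (α δ ρ : ℝ) (y : ℕ → ℝ) : Set (ℕ → ℝ) :=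
  {f | hNorm δ (f - posteriorMean n α y) ≤ ENNReal.ofReal (ρ / √n)}

/-- The set of all `f` with `‖f - f̂‖_{H(δ)} ≤ ρ / √n` and
`‖f - f̂‖_{H^{α-ε}} ≤ C √(log n)`. -/
def hCredibleSet (n : ℕ) (α δ ρ ε C : ℝ) (y : ℕ → ℝ) : Set (ℕ → ℝ) :=
  hBall n α δ ρ y ∩
    {f | sobolevNorm (α - ε) (f - posteriorMean n α y) ≤ ENNReal.ofReal (C * √(Real.log n))}

/-- The ball `{f : ‖f - f̂‖₂ ≤ q}` around the posterior mean. -/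
def l2Ball (n : ℕ) (α q : ℝ) (y : ℕ → ℝ) : Set (ℕ → ℝ) :=
  {f | l2Norm (f - posteriorMean n α y) ≤ ENNReal.ofReal q}

/-- The radii `ρ` for which the `H(δ)`-ball has posterior probability `1 - γ`. -/
def hRadii (n : ℕ) (α δ γ : ℝ) (y : ℕ → ℝ) : Set ℝ :=
  {ρ | 0 ≤ ρ ∧ (posterior n α y).real (hBall n α δ ρ y) = 1 - γ}

/-- The radii `q` for which the `ℓ₂`-ball has posterior probability `1 - γ`. -/
def l2Radii (n : ℕ) (α γ : ℝ) (y : ℕ → ℝ) : Set ℝ :=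
  {q | 0 ≤ q ∧ (posterior n α y).real (l2Ball n α q y) = 1 - γ}

/-- `x` is a (data-dependent) selection from the sets `S n y`: whenever `S n y` is non-empty,
`x n y` is one of its elements. Nothing is required of `x n y` if `S n y` is empty. -/
def IsSelection (x : ℕ → (ℕ → ℝ) → ℝ) (S : ℕ → (ℕ → ℝ) → Set ℝ) : Prop :=
  ∀ n y, (S n y).Nonempty → x n y ∈ S n y

/-- `X_n = o_P(1)` uniformly over the truths in `Q`: for every `η > 0`,
`sup_{f₀ ∈ Q} P_{f₀}(|X_n(Y)| ≥ η) → 0` (in outer probability if `X_n` is not measurable). -/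
def UniformlyTendsToZeroInProbability (Q : Set (ℕ → ℝ)) (X : ℕ → (ℕ → ℝ) → ℝ) : Prop :=
  ∀ η : ℝ, 0 < η →
    Tendsto (fun n => ⨆ f₀ ∈ Q, dataLaw n f₀ {y | η ≤ |X n y|}) atTop (𝓝 0)

end SeqModel

end

/-! Under the posterior the normalized deviations from the mean are i.i.d. standard normal, so each
ball is a sublevel set of a weighted chi-square sum whose weights depend on `n` and `α` but not on
the data (`posterior_real_preimage`). It suffices to have estimates for such sums that are uniform
in `α`, and to confine the random `α` to a good range.

Independence: after multiplication by `n`, the weights of the squared `H(δ)`-norm are dominated by a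
fixed summable sequence, so up to a small error this norm lives on a finite set `S` of coordinates.
The squared `ℓ₂`-norm has, because `a = o(log n)`, any prescribed number of rescaled weights at
least `1 / 2`; it is spread over so large a scale that dropping the coordinates in `S` hardly
matters. The truncated norms are exactly independent. That a small perturbation of a sum hardly
changes the probability of a sublevel set is anti-concentration, read off from the characteristic
function of a chi-square variable (`measureReal_chiSum_le`, `abs_chiSum_inter_sub_mul_le`).

The Sobolev constraint is asymptotically free: the squared norm has mean at most `1 + 1 / (2 ε) ≤ 1
+ log n / (2 r₁)` and bounded variance, so Chebyshev's inequality and `1 / (2 r₁) < C ^ 2` apply.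

Range of `α`: for `α ≤ c` the criterion `-2 ℓ_n` pays a positive constant for each of the roughly `n
^ κ` coordinates with `k ^ (2 c + 1) ≤ n`. At `α = 1` the cost, the loss of signal and the
stochastic errors are all `O(n ^ (1 - t))` with `1 - t < κ` (`IsRegularNoise.logLikelihood_lt`,
`lintegral_noiseError_le`). Hence, with high probability, maximizers exist and are at least `c`,
which makes the `ℓ₂`-radius and the interval for `ε` available. -/

noncomputable section

namespace SeqModel

/-! ### Weighted chi-square sums: moments, independence, tails -/

/-- The law of a sequence of independent standard normal variables. -/
def stdNoise : Measure (ℕ → ℝ) := Measure.infinitePi (fun _ => gaussianReal 0 1)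

instance : IsProbabilityMeasure stdNoise := by unfold stdNoise; infer_instance

/-- The weighted chi-square variable `∑ k, w k * z k ^ 2`. -/
def chiSum (w z : ℕ → ℝ) : ℝ≥0∞ := ∑' k, ENNReal.ofReal (w k * z k ^ 2)

lemma measurable_chiSum (w : ℕ → ℝ) : Measurable (chiSum w) := by
  unfold chiSum
  exact Measurable.tsum fun k => by fun_prop

lemma measurePreserving_eval_stdNoise (k : ℕ) :
    MeasurePreserving (Function.eval k) stdNoise (gaussianReal 0 1) :=
  measurePreserving_eval_infinitePi (fun _ : ℕ => gaussianReal 0 1) k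

lemma integral_sq_gaussian : ∫ x, x ^ 2 ∂(gaussianReal 0 1) = 1 := by
  have h := variance_fun_id_gaussianReal (μ := 0) (v := 1)
  rw [variance_eq_integral (by fun_prop)] at h
  simpa using h

lemma memLp_sq_gaussian : MemLp (fun x : ℝ => x ^ 2) 2 (gaussianReal 0 1) := by
  have h := (memLp_id_gaussianReal (μ := 0) (v := 1) 4)
  rw [memLp_two_iff_integrable_sq (by fun_prop)]
  have h4 := h.integrable_norm_pow (by norm_num)
  refine h4.congr (ae_of_all _ fun x => ?_)
  simp only [id, Real.norm_eq_abs]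
  rw [← abs_pow, abs_of_nonneg (by positivity)]
  ring

lemma integrable_sq_gaussian : Integrable (fun x : ℝ => x ^ 2) (gaussianReal 0 1) :=
  memLp_sq_gaussian.integrable (by norm_num)

lemma lintegral_ofReal_mul_sq (w : ℝ) (hw : 0 ≤ w) (k : ℕ) :
    ∫⁻ z, ENNReal.ofReal (w * z k ^ 2) ∂stdNoise = ENNReal.ofReal w := by
  rw [(measurePreserving_eval_stdNoise k).lintegral_comp
    (f := fun x : ℝ => ENNReal.ofReal (w * x ^ 2)) (by fun_prop),
    ← ofReal_integral_eq_lintegral_ofReal (integrable_sq_gaussian.const_mul w)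
      (ae_of_all _ fun x => by positivity), integral_const_mul, integral_sq_gaussian, mul_one]

lemma lintegral_chiSum {w : ℕ → ℝ} (hw : ∀ k, 0 ≤ w k) :
    ∫⁻ z, chiSum w z ∂stdNoise = ∑' k, ENNReal.ofReal (w k) := by
  unfold chiSum
  rw [lintegral_tsum (fun k => Measurable.aemeasurable (by fun_prop))]
  exact tsum_congr fun k => lintegral_ofReal_mul_sq _ (hw k) k

lemma chiSum_ne_top_ae {w : ℕ → ℝ} (hw : ∀ k, 0 ≤ w k) (hs : Summable w) :
    ∀ᵐ z ∂stdNoise, chiSum w z ≠ ∞ := by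
  refine (ae_lt_top (measurable_chiSum w) ?_).mono fun z hz => hz.ne
  rw [lintegral_chiSum hw]
  exact hs.tsum_ofReal_ne_top

lemma iIndepFun_eval : iIndepFun (fun (k : ℕ) (z : ℕ → ℝ) => z k) stdNoise :=
  iIndepFun_infinitePi (X := fun _ (x : ℝ) => x) (fun _ => measurable_id)

lemma iIndepFun_comp {f : ℕ → ℝ → ℝ} (hf : ∀ k, Measurable (f k)) :
    iIndepFun (fun (k : ℕ) (z : ℕ → ℝ) => f k (z k)) stdNoise :=
  iIndepFun_infinitePi (X := f) hf

/-- Weighted chi-square variables with disjoint supports are independent. -/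
lemma indepFun_chiSum {w w' : ℕ → ℝ} (h : ∀ k, w k = 0 ∨ w' k = 0) :
    IndepFun (chiSum w) (chiSum w') stdNoise := by
  have key := indep_iSup_of_disjoint (m := fun k : ℕ =>
      MeasurableSpace.comap (fun z : ℕ → ℝ => z k) inferInstance) (μ := stdNoise)
      (fun k => (measurable_pi_apply k).comap_le) iIndepFun_eval
      (S := {k | w k ≠ 0}) (T := {k | w k = 0})
      (by rw [Set.disjoint_left]; intro k h1 h2; exact h1 h2)
  have hmeas : ∀ (v : ℕ → ℝ) (S : Set ℕ), (∀ k, k ∉ S → v k = 0) →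
      Measurable[⨆ k ∈ S, MeasurableSpace.comap (fun z : ℕ → ℝ => z k) inferInstance]
        (chiSum v) := by
    intro v S hv
    unfold chiSum
    refine Measurable.ennreal_tsum fun k => ?_
    by_cases hk : k ∈ S
    · have h1 : Measurable[MeasurableSpace.comap (fun z : ℕ → ℝ => z k) inferInstance]
          (fun z : ℕ → ℝ => z k) := comap_measurable _
      have h2 := h1.mono (le_iSup₂_of_le (f := fun (k : ℕ) (_ : k ∈ S) =>
        MeasurableSpace.comap (fun z : ℕ → ℝ => z k) inferInstance) k hk le_rfl) le_rfl
      exact (by fun_prop : Measurable fun x : ℝ => ENNReal.ofReal (v k * x ^ 2)).comp h2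
    · simp only [hv k hk, zero_mul, ENNReal.ofReal_zero]
      exact measurable_const
  rw [IndepFun_iff_Indep]
  refine indep_of_indep_of_le_left (indep_of_indep_of_le_right key ?_) ?_
  · exact (hmeas w' _ fun k hk => (h k).resolve_left hk).comap_le
  · exact (hmeas w _ fun k hk => by simpa using hk).comap_le

/-- The variance of the square of a standard normal variable. -/
def sqVar : ℝ := Var[fun x : ℝ => x ^ 2; gaussianReal 0 1]

lemma sqVar_nonneg : 0 ≤ sqVar := variance_nonneg _ _

lemma variance_sum_mul_sq (w : ℕ → ℝ) (s : Finset ℕ) :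
    Var[fun z : ℕ → ℝ => ∑ k ∈ s, w k * z k ^ 2; stdNoise] = sqVar * ∑ k ∈ s, w k ^ 2 := by
  have hL : ∀ k, MemLp (fun z : ℕ → ℝ => w k * z k ^ 2) 2 stdNoise := fun k =>
    (memLp_sq_gaussian.const_mul (w k)).comp_measurePreserving (measurePreserving_eval_stdNoise k)
  have h := IndepFun.variance_sum (X := fun k (z : ℕ → ℝ) => w k * z k ^ 2) (s := s)
    (fun k _ => hL k) (fun i _ j _ hij =>
      (iIndepFun_comp (f := fun k x => w k * x ^ 2) (fun k => by fun_prop)).indepFun hij)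
  have e : (fun z : ℕ → ℝ => ∑ k ∈ s, w k * z k ^ 2) =
      ∑ k ∈ s, fun z : ℕ → ℝ => w k * z k ^ 2 := by ext z; simp
  rw [e, h, Finset.mul_sum]
  refine Finset.sum_congr rfl fun k _ => ?_
  have := (measurePreserving_eval_stdNoise k).variance_fun_comp
    (f := fun x : ℝ => w k * x ^ 2) (by fun_prop)
  change Var[fun z : ℕ → ℝ => w k * (Function.eval k z) ^ 2; stdNoise] = _
  rw [this, variance_const_mul, sqVar]
  ring

lemma integral_mul_sq (w : ℕ → ℝ) (k : ℕ) : ∫ z, w k * z k ^ 2 ∂stdNoise = w k := by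
  have h := integral_map (μ := stdNoise) (φ := Function.eval k)
    (f := fun x : ℝ => w k * x ^ 2) (measurable_pi_apply k).aemeasurable (by fun_prop)
  rw [(measurePreserving_eval_stdNoise k).map_eq, integral_const_mul, integral_sq_gaussian,
    mul_one] at h
  exact h.symm

lemma integrable_mul_sq (w : ℝ) (k : ℕ) : Integrable (fun z => w * z k ^ 2) stdNoise :=
  (measurePreserving_eval_stdNoise k).integrable_comp_of_integrable
    (integrable_sq_gaussian.const_mul w)

lemma memLp_sum_mul_sq (w : ℕ → ℝ) (s : Finset ℕ) :
    MemLp (fun z : ℕ → ℝ => ∑ k ∈ s, w k * z k ^ 2) 2 stdNoise :=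
  memLp_finsetSum s fun k _ =>
    (memLp_sq_gaussian.const_mul (w k)).comp_measurePreserving (measurePreserving_eval_stdNoise k)

/-- Chebyshev's inequality for the upper tail of a weighted chi-square variable. -/
lemma chiSum_upper_tail {w : ℕ → ℝ} (hw : ∀ k, 0 ≤ w k) {m v t : ℝ}
    (hm : ∀ s : Finset ℕ, ∑ k ∈ s, w k ≤ m) (hv : ∀ s : Finset ℕ, ∑ k ∈ s, w k ^ 2 ≤ v)
    (ht : 0 < t) :
    stdNoise {z | ENNReal.ofReal (m + t) < chiSum w z} ≤ ENNReal.ofReal (sqVar * v / t ^ 2) := by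
  have hm0 : 0 ≤ m := by simpa using hm ∅
  -- The partial sums increase to the series, so the event is covered by an increasing union;
  -- Chebyshev's bound for each finite sum does not depend on `N` and survives the limit.
  set A : ℕ → Set (ℕ → ℝ) := fun N => {z | m + t < ∑ k ∈ Finset.range N, w k * z k ^ 2} with hA
  have hsub : {z | ENNReal.ofReal (m + t) < chiSum w z} ⊆ ⋃ N, A N := by
    intro z hz
    simp only [mem_ofPred_eq, chiSum, ENNReal.tsum_eq_iSup_nat, lt_iSup_iff] at hz
    obtain ⟨N, hN⟩ := hz
    rw [← ENNReal.ofReal_sum_of_nonneg (fun k _ => mul_nonneg (hw k) (sq_nonneg _))] at hN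
    exact mem_iUnion.2 ⟨N, (ENNReal.ofReal_lt_ofReal_iff_of_nonneg (by positivity)).1 hN⟩
  have hmono : Monotone A := by
    intro N N' h z hz
    exact lt_of_lt_of_le hz (Finset.sum_le_sum_of_subset_of_nonneg
      (Finset.range_mono h) fun k _ _ => mul_nonneg (hw k) (sq_nonneg _))
  refine (measure_mono hsub).trans ?_
  rw [hmono.measure_iUnion]
  refine iSup_le fun N => ?_
  have hE : ∫ z, ∑ k ∈ Finset.range N, w k * z k ^ 2 ∂stdNoise = ∑ k ∈ Finset.range N, w k := by
    rw [integral_finsetSum _ fun k _ => integrable_mul_sq _ _]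
    exact Finset.sum_congr rfl fun k _ => integral_mul_sq w k
  have hc := meas_ge_le_variance_div_sq (memLp_sum_mul_sq w (Finset.range N)) ht
  rw [variance_sum_mul_sq, hE] at hc
  refine (measure_mono ?_).trans (hc.trans (ENNReal.ofReal_le_ofReal ?_))
  · intro z hz
    have h1 : m + t < ∑ k ∈ Finset.range N, w k * z k ^ 2 := hz
    have h2 := hm (Finset.range N)
    exact (by linarith : t ≤ _ - _).trans (le_abs_self _)
  · gcongr
    · exact sqVar_nonneg
    · exact hv _

/-- Normalization of a Gaussian product measure. -/
lemma map_infinitePi_gaussianReal (m : ℕ → ℝ) (v : ℕ → ℝ≥0) (hv : ∀ k, v k ≠ 0) :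
    (Measure.infinitePi (fun k => gaussianReal (m k) (v k))).map
      (fun f k => (f k - m k) / √(v k)) = stdNoise := by
  rw [Measure.infinitePi_map_pi (f := fun k x => (x - m k) / √(v k)) _ (fun k => by fun_prop)]
  unfold stdNoise
  congr 1
  ext1 k
  have h1 := gaussianReal_map_sub_const (μ := m k) (v := v k) (m k)
  have h2 := gaussianReal_map_div_const (μ := 0) (v := v k) (√(v k))
  rw [← sub_self (m k), ← h1, Measure.map_map (by fun_prop) (by fun_prop)] at h2
  change Measure.map ((fun x => x / √(v k)) ∘ fun x => x - m k) _ = _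
  rw [h2]
  congr 1
  · simp
  · ext
    simp only [NNReal.coe_div, NNReal.coe_one, NNReal.coe_mk, Real.sq_sqrt (NNReal.coe_nonneg _)]
    exact div_self (by simpa using hv k)

/-! ### Anti-concentration via characteristic functions -/

open Complex in
/-- The modulus of the characteristic function of a scaled chi-square variable. -/
lemma norm_charFun_map_mul_sq (w t : ℝ) :
    ‖charFun ((gaussianReal 0 1).map fun x => w * x ^ 2) t‖ =
      (1 + 4 * (w * t) ^ 2) ^ (-(1 / 4 : ℝ)) := by
  have hb : 0 < ((1 / 2 : ℂ) - (t * w : ℝ) * I).re := by simp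
  rw [charFun_apply_real, integral_map (by fun_prop) (by fun_prop),
    integral_gaussianReal_eq_integral_smul (by norm_num)]
  have h1 : ∀ x : ℝ, gaussianPDFReal 0 1 x • cexp (t * ((w * x ^ 2 : ℝ) : ℂ) * I) =
      ((√(2 * Real.pi))⁻¹ : ℝ) * cexp (-((1 / 2 : ℂ) - (t * w : ℝ) * I) * x ^ 2) := by
    intro x
    rw [gaussianPDFReal_def, real_smul]
    push_cast
    rw [mul_assoc, ← Complex.exp_add]
    simp only [sub_zero, mul_one]
    congr 2
    ring
  simp_rw [h1]
  rw [integral_const_mul, integral_gaussian_complex hb, norm_mul]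
  have hpos : (0 : ℝ) < 1 + 4 * (w * t) ^ 2 := by positivity
  have hn : ‖(1 / 2 : ℂ) - (t * w : ℝ) * I‖ = √(1 + 4 * (w * t) ^ 2) / 2 := by
    rw [Complex.norm_eq_sqrt_sq_add_sq]
    have : (1 + 4 * (w * t) ^ 2) = 2 ^ 2 * (((1 / 2 : ℂ) - (t * w : ℝ) * I).re ^ 2 +
      ((1 / 2 : ℂ) - (t * w : ℝ) * I).im ^ 2) := by
      simp
      ring
    rw [this, Real.sqrt_mul (by norm_num), Real.sqrt_sq (by norm_num)]
    ring
  have h2 : ‖((Real.pi : ℂ) / ((1 / 2 : ℂ) - (t * w : ℝ) * I)) ^ (1 / 2 : ℂ)‖ =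
      (Real.pi / (√(1 + 4 * (w * t) ^ 2) / 2)) ^ (1 / 2 : ℝ) := by
    have : (1 / 2 : ℂ) = ((1 / 2 : ℝ) : ℂ) := by norm_num
    rw [← hn, this, Complex.norm_cpow_real, norm_div, Complex.norm_real, Real.norm_eq_abs,
      abs_of_pos Real.pi_pos, ← this]
  rw [h2, Complex.norm_real, Real.norm_of_nonneg (by positivity), Real.sqrt_eq_rpow,
    Real.sqrt_eq_rpow, div_div_eq_mul_div, mul_comm Real.pi 2,
    Real.div_rpow (by positivity) (by positivity), ← Real.rpow_mul hpos.le,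
    Real.rpow_neg hpos.le]
  have : (2 * Real.pi) ^ (1 / 2 : ℝ) ≠ 0 := by positivity
  field_simp
  norm_num

/-- An Esseen type inequality: the concentration function is controlled by a Gaussian average
of the modulus of the characteristic function. -/
lemma measureReal_abs_sub_le (ν : Measure ℝ) [IsProbabilityMeasure ν] (x : ℝ) {M : ℝ}
    (hM : 0 < M) :
    ν.real {s | |s - x| ≤ M} ≤
      Real.exp (1 / 2) * ∫ g, ‖charFun ν (g / M)‖ ∂(gaussianReal 0 1) := by
  -- The Gaussian kernel is the characteristic function of a Gaussian, so Fubini turns its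
  -- `ν`-average into a Gaussian average of `charFun ν`. The factor `exp (1 / 2)` comes from
  -- bounding the indicator of `|s - x| ≤ M` by the kernel.
  have hgauss : ∀ s : ℝ, ((Real.exp (-(((s - x) / M) ^ 2 / 2)) : ℝ) : ℂ) =
      ∫ g, Complex.exp (((s - x) / M : ℝ) * g * Complex.I) ∂(gaussianReal 0 1) := by
    intro s
    rw [← charFun_apply_real, charFun_gaussianReal]
    push_cast
    simp
  have hint : Integrable (fun s : ℝ => Real.exp (-(((s - x) / M) ^ 2 / 2))) ν := by
    refine Integrable.of_bound (by fun_prop) 1 (ae_of_all _ fun s => ?_)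
    rw [Real.norm_of_nonneg (by positivity), Real.exp_le_one_iff]
    have : 0 ≤ ((s - x) / M) ^ 2 := sq_nonneg _
    linarith
  have hmeas : MeasurableSet {s : ℝ | |s - x| ≤ M} :=
    measurableSet_le (by fun_prop) measurable_const
  have h1 : ν.real {s | |s - x| ≤ M} ≤
      Real.exp (1 / 2) * ∫ s, Real.exp (-(((s - x) / M) ^ 2 / 2)) ∂ν := by
    rw [← integral_const_mul, ← integral_indicator_one hmeas]
    refine integral_mono_of_nonneg (ae_of_all _ fun s => indicator_nonneg (by simp) s)
      (hint.const_mul _) (ae_of_all _ fun s => ?_)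
    by_cases hs : |s - x| ≤ M
    · rw [indicator_of_mem (by exact hs), Pi.one_apply]
      change 1 ≤ Real.exp (1 / 2) * Real.exp (-(((s - x) / M) ^ 2 / 2))
      rw [← Real.exp_add, Real.one_le_exp_iff]
      have : |(s - x) / M| ≤ 1 := by rwa [abs_div, abs_of_pos hM, div_le_one hM]
      have := (sq_le_one_iff_abs_le_one _).2 this
      linarith
    · rw [indicator_of_notMem (by exact hs)]
      positivity
  refine h1.trans (mul_le_mul_of_nonneg_left ?_ (Real.exp_pos _).le)
  have h2 : ((∫ s, Real.exp (-(((s - x) / M) ^ 2 / 2)) ∂ν : ℝ) : ℂ) =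
      ∫ g, Complex.exp (-(x * (g / M)) * Complex.I) * charFun ν (g / M) ∂(gaussianReal 0 1) := by
    rw [← integral_complex_ofReal]
    simp_rw [hgauss]
    rw [integral_integral_swap]
    · refine integral_congr_ae (ae_of_all _ fun g => ?_)
      simp only
      rw [charFun_apply_real, ← integral_const_mul]
      refine integral_congr_ae (ae_of_all _ fun s => ?_)
      simp only
      rw [← Complex.exp_add]
      congr 1
      push_cast
      field_simp
      ring
    · refine Integrable.of_bound (by fun_prop) 1 (ae_of_all _ fun p => ?_)
      simp only [Function.uncurry]
      rw [← Complex.ofReal_mul, Complex.norm_exp_ofReal_mul_I]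
  have h3 : ∫ s, Real.exp (-(((s - x) / M) ^ 2 / 2)) ∂ν ≤
      ‖((∫ s, Real.exp (-(((s - x) / M) ^ 2 / 2)) ∂ν : ℝ) : ℂ)‖ := by
    rw [Complex.norm_real]
    exact le_abs_self _
  refine h3.trans ?_
  rw [h2]
  refine (norm_integral_le_integral_norm _).trans (le_of_eq ?_)
  refine integral_congr_ae (ae_of_all _ fun g => ?_)
  simp only
  rw [norm_mul]
  have : -((x : ℂ) * (g / M)) = ((-(x * (g / M)) : ℝ) : ℂ) := by push_cast; ring
  rw [this, Complex.norm_exp_ofReal_mul_I, one_mul]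

/-- A bound for the concentration function of a weighted sum of `N` chi-square variables, at the
scale `1 / s` relative to the smallest weight. -/
def concBound (N : ℕ) (s : ℝ) : ℝ :=
  Real.exp (1 / 2) * ∫ g, (1 + 4 * (s * g) ^ 2) ^ (-(N / 4 : ℝ)) ∂(gaussianReal 0 1)

lemma continuous_concBound_integrand (N : ℕ) (s : ℝ) :
    Continuous fun g : ℝ => (1 + 4 * (s * g) ^ 2) ^ (-(N / 4 : ℝ)) :=
  Continuous.rpow_const (by fun_prop) fun g => Or.inl (by positivity)

lemma concBound_integrand_le_one (N : ℕ) (s g : ℝ) :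
    (1 + 4 * (s * g) ^ 2) ^ (-(N / 4 : ℝ)) ≤ 1 :=
  Real.rpow_le_one_of_one_le_of_nonpos (by nlinarith [sq_nonneg (s * g)])
    (by simp only [Left.neg_nonpos_iff]; positivity)

lemma gaussian_ae_ne_zero : ∀ᵐ g ∂(gaussianReal 0 1), g ≠ 0 := by
  have := nullSingletonClass_gaussianReal (μ := 0) (v := 1) (by norm_num)
  simp [ae_iff]

lemma integrable_concBound_integrand (N : ℕ) (s : ℝ) :
    Integrable (fun g : ℝ => (1 + 4 * (s * g) ^ 2) ^ (-(N / 4 : ℝ))) (gaussianReal 0 1) :=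
  Integrable.of_bound (continuous_concBound_integrand N s).aestronglyMeasurable 1
    (ae_of_all _ fun g => by
      rw [Real.norm_of_nonneg (by positivity)]
      exact concBound_integrand_le_one N s g)

lemma concBound_nonneg (N : ℕ) (s : ℝ) : 0 ≤ concBound N s :=
  mul_nonneg (Real.exp_pos _).le (integral_nonneg fun g => by positivity)

/-- Dominated convergence with the constant majorant 1. At `g = 0` the integrand is always 1, but
this point is null. -/
lemma tendsto_concBound_aux {ι : Type*} {l : Filter ι} [l.IsCountablyGenerated]
    (N : ι → ℕ) (s : ι → ℝ)
    (h : ∀ g : ℝ, g ≠ 0 → Tendsto (fun i => (1 + 4 * (s i * g) ^ 2) ^ (-(N i / 4 : ℝ))) l (𝓝 0)) :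
    Tendsto (fun i => concBound (N i) (s i)) l (𝓝 0) := by
  have : Tendsto (fun i => ∫ g, (1 + 4 * (s i * g) ^ 2) ^ (-(N i / 4 : ℝ)) ∂(gaussianReal 0 1)) l
      (𝓝 (∫ _, (0 : ℝ) ∂(gaussianReal 0 1))) := by
    refine tendsto_integral_filter_of_dominated_convergence (fun _ => 1)
      (Eventually.of_forall fun i =>
        (continuous_concBound_integrand _ _).aestronglyMeasurable)
      (Eventually.of_forall fun i => ae_of_all _ fun g => ?_) (integrable_const _) ?_
    · rw [Real.norm_of_nonneg (by positivity)]
      exact concBound_integrand_le_one _ _ g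
    · exact gaussian_ae_ne_zero.mono fun g hg => h g hg
  unfold concBound
  simpa using this.const_mul (Real.exp (1 / 2))

/-- Many coordinates at a fixed scale: this is the regime of the `ℓ₂`-norm. -/
lemma tendsto_concBound_card {s : ℝ} (hs : s ≠ 0) :
    Tendsto (fun N => concBound N s) atTop (𝓝 0) := by
  refine tendsto_concBound_aux (fun N => N) (fun _ => s) fun g hg => ?_
  have h1 : 1 < 1 + 4 * (s * g) ^ 2 := by
    have : 0 < (s * g) ^ 2 := by positivity
    linarith
  have h2 : Tendsto (fun N : ℕ => (((1 + 4 * (s * g) ^ 2) ^ (-(1 / 4) : ℝ)) ^ N : ℝ)) atTop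
      (𝓝 0) :=
    tendsto_pow_atTop_nhds_zero_of_lt_one (by positivity)
      (Real.rpow_lt_one_of_one_lt_of_neg h1 (by norm_num))
  refine h2.congr fun N => ?_
  rw [← Real.rpow_natCast, ← Real.rpow_mul (by positivity)]
  congr 1
  ring

/-- One coordinate and a window shrinking relative to its weight: this is the regime of the
`H(δ)`-norm, and it also yields continuity of the distribution functions. -/
lemma tendsto_concBound_scale : Tendsto (concBound 1) atTop (𝓝 0) := by
  refine tendsto_concBound_aux (fun _ => 1) (fun s => s) fun g hg => ?_
  have h1 : Tendsto (fun s : ℝ => 1 + 4 * (s * g) ^ 2) atTop atTop := by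
    refine tendsto_atTop_add_const_left _ _ (Tendsto.const_mul_atTop (by norm_num) ?_)
    simp_rw [mul_pow]
    exact (tendsto_pow_atTop (by norm_num)).atTop_mul_const (by positivity)
  simpa [Function.comp_def] using
    (tendsto_rpow_neg_atTop (y := (1 / 4 : ℝ)) (by norm_num)).comp h1

/-- Anti-concentration of finite weighted sums of independent chi-square variables. -/
lemma measureReal_abs_sum_sub_le {w : ℕ → ℝ} {w₀ : ℝ} (hw₀ : 0 ≤ w₀) {F : Finset ℕ}
    (hw : ∀ k ∈ F, w₀ ≤ w k) (x : ℝ) {M : ℝ} (hM : 0 < M) :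
    stdNoise.real {z | |∑ k ∈ F, w k * z k ^ 2 - x| ≤ M} ≤ concBound F.card (w₀ / M) := by
  have hm : Measurable fun z : ℕ → ℝ => ∑ k ∈ F, w k * z k ^ 2 := by fun_prop
  have : IsProbabilityMeasure (stdNoise.map fun z : ℕ → ℝ => ∑ k ∈ F, w k * z k ^ 2) :=
    Measure.isProbabilityMeasure_map hm.aemeasurable
  have h := measureReal_abs_sub_le (stdNoise.map fun z : ℕ → ℝ => ∑ k ∈ F, w k * z k ^ 2) x hM
  rw [map_measureReal_apply hm (measurableSet_le (by fun_prop) measurable_const)] at h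
  refine h.trans (mul_le_mul_of_nonneg_left ?_ (Real.exp_pos _).le)
  have hI : iIndepFun (F.restrict fun (k : ℕ) (z : ℕ → ℝ) => w k * z k ^ 2) stdNoise :=
    (iIndepFun_comp (f := fun k x => w k * x ^ 2) (fun k => by fun_prop)).restrict F
  have hcf := iIndepFun.charFun_map_fun_finsetSum_eq_prod (P := stdNoise) (s := F)
    (X := fun (k : ℕ) (z : ℕ → ℝ) => w k * z k ^ 2) (fun k _ => Measurable.aemeasurable (by fun_prop)) hI
  refine integral_mono_of_nonneg (ae_of_all _ fun g => norm_nonneg _)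
    (integrable_concBound_integrand _ _) (ae_of_all _ fun g => ?_)
  simp only
  rw [hcf, Finset.prod_apply, norm_prod]
  have h1 : ∀ k ∈ F, ‖charFun (stdNoise.map fun z : ℕ → ℝ => w k * z k ^ 2) (g / M)‖ ≤
      (1 + 4 * (w₀ / M * g) ^ 2) ^ (-(1 / 4 : ℝ)) := by
    intro k hk
    have : stdNoise.map (fun z : ℕ → ℝ => w k * z k ^ 2) =
        (gaussianReal 0 1).map fun x => w k * x ^ 2 := by
      rw [← (measurePreserving_eval_stdNoise k).map_eq, Measure.map_map (by fun_prop)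
        (by fun_prop)]
      rfl
    rw [this, norm_charFun_map_mul_sq]
    refine Real.rpow_le_rpow_of_nonpos (by positivity) ?_ (by norm_num)
    have e1 : (w₀ / M * g) ^ 2 = w₀ ^ 2 * (g / M) ^ 2 := by ring
    have e2 : (w k * (g / M)) ^ 2 = w k ^ 2 * (g / M) ^ 2 := by ring
    have := hw k hk
    rw [e1, e2]
    gcongr
  refine (Finset.prod_le_prod (fun _ _ => norm_nonneg _) h1).trans (le_of_eq ?_)
  rw [Finset.prod_const, ← Real.rpow_natCast, ← Real.rpow_mul (by positivity)]
  congr 1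
  ring

lemma chiSum_eq_add (w : ℕ → ℝ) (F : Finset ℕ) (hw : ∀ k, 0 ≤ w k) (z : ℕ → ℝ) :
    chiSum w z = ENNReal.ofReal (∑ k ∈ F, w k * z k ^ 2) +
      chiSum (fun k => if k ∈ F then 0 else w k) z := by
  have : chiSum w z = chiSum (fun k => if k ∈ F then w k else 0) z +
      chiSum (fun k => if k ∈ F then 0 else w k) z := by
    unfold chiSum
    rw [← ENNReal.tsum_add]
    refine tsum_congr fun k => ?_
    by_cases hk : k ∈ F <;> simp [hk]
  rw [this]
  congr 1
  unfold chiSum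
  rw [tsum_eq_sum (s := F) (fun k hk => by simp [hk]),
    ENNReal.ofReal_sum_of_nonneg fun k _ => mul_nonneg (hw k) (sq_nonneg _)]
  exact Finset.sum_congr rfl fun k hk => by simp [hk]

/-- Anti-concentration of weighted chi-square variables. -/
lemma measureReal_chiSum_le {w : ℕ → ℝ} (hw : ∀ k, 0 ≤ w k) {w₀ : ℝ} (hw₀ : 0 ≤ w₀)
    {F : Finset ℕ} (hF : ∀ k ∈ F, w₀ ≤ w k) (x : ℝ) {M : ℝ} (hM : 0 < M) :
    stdNoise.real {z | chiSum w z ≠ ∞ ∧ |(chiSum w z).toReal - x| ≤ M} ≤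
      concBound F.card (w₀ / M) := by
  set w₁ : ℕ → ℝ := fun k => if k ∈ F then w k else 0 with hw₁
  set w₂ : ℕ → ℝ := fun k => if k ∈ F then 0 else w k with hw₂
  have hsum : ∀ z, ENNReal.ofReal (∑ k ∈ F, w k * z k ^ 2) = chiSum w₁ z := by
    intro z
    unfold chiSum
    rw [tsum_eq_sum (s := F) (fun k hk => by simp [hw₁, hk]),
      ENNReal.ofReal_sum_of_nonneg fun k _ => mul_nonneg (hw k) (sq_nonneg _)]
    exact Finset.sum_congr rfl fun k hk => by simp [hw₁, hk]
  have hind : IndepFun (chiSum w₂) (chiSum w₁) stdNoise := by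
    refine indepFun_chiSum fun k => ?_
    by_cases hk : k ∈ F <;> simp [hw₁, hw₂, hk]
  have hmap := (indepFun_iff_map_prod_eq_prod_map_map (measurable_chiSum w₂).aemeasurable
    (measurable_chiSum w₁).aemeasurable).1 hind
  -- Finiteness is part of the event because `toReal` sends `∞` to `0`.
  set B : Set (ℝ≥0∞ × ℝ≥0∞) := {p | p.1 + p.2 ≠ ∞ ∧ |(p.1 + p.2).toReal - x| ≤ M} with hB
  have hBm : MeasurableSet B := by
    refine MeasurableSet.inter ?_ ?_
    · exact (measurableSet_eq_fun (f := fun p : ℝ≥0∞ × ℝ≥0∞ => p.1 + p.2) (by fun_prop)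
        measurable_const).compl
    · exact measurableSet_le (f := fun p : ℝ≥0∞ × ℝ≥0∞ => |(p.1 + p.2).toReal - x|)
        (by fun_prop) measurable_const
  have hset : {z | chiSum w z ≠ ∞ ∧ |(chiSum w z).toReal - x| ≤ M} =
      (fun z => (chiSum w₂ z, chiSum w₁ z)) ⁻¹' B := by
    ext z
    simp only [hB, mem_preimage, mem_ofPred_eq]
    rw [chiSum_eq_add w F hw z, hsum, add_comm]
  rw [hset, measureReal_def]
  refine ENNReal.toReal_le_of_le_ofReal (concBound_nonneg _ _) ?_
  rw [← Measure.map_apply ((measurable_chiSum _).prodMk (measurable_chiSum _)) hBm, hmap,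
    Measure.prod_apply hBm]
  have hprob : IsProbabilityMeasure (stdNoise.map (chiSum w₂)) :=
    Measure.isProbabilityMeasure_map (measurable_chiSum w₂).aemeasurable
  -- Conditionally on the coordinates outside `F`, the event is a window for the finite sum
  -- recentred at `x - r`, and the finite bound does not depend on the centre.
  have hle : ∀ r, stdNoise.map (chiSum w₁) (Prod.mk r ⁻¹' B) ≤
      ENNReal.ofReal (concBound F.card (w₀ / M)) := by
    intro r
    rw [Measure.map_apply (measurable_chiSum _) (hBm.preimage (by fun_prop))]
    refine le_trans (measure_mono ?_) (ENNReal.le_ofReal_iff_toReal_le (measure_ne_top _ _)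
      (concBound_nonneg _ _) |>.2 (measureReal_abs_sum_sub_le hw₀ hF (x - r.toReal) hM))
    intro z hz
    simp only [hB, mem_preimage, mem_ofPred_eq, ← hsum] at hz ⊢
    have h0 : 0 ≤ ∑ k ∈ F, w k * z k ^ 2 :=
      Finset.sum_nonneg fun k _ => mul_nonneg (hw k) (sq_nonneg _)
    rw [ENNReal.toReal_add (fun h => hz.1 (by simp [h])) ENNReal.ofReal_ne_top,
      ENNReal.toReal_ofReal h0] at hz
    convert hz.2 using 2
    ring
  refine (lintegral_mono hle).trans ?_
  rw [lintegral_const, measure_univ, mul_one]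

/-! ### Approximate independence -/

lemma measurableSet_chiSum_le (w : ℕ → ℝ) (x : ℝ≥0∞) : MeasurableSet {z | chiSum w z ≤ x} :=
  measurableSet_le (measurable_chiSum w) measurable_const

/-- Restricting the weights to a set of coordinates changes the probability of a sublevel set by
at most the concentration function plus a first moment term. -/
lemma measureReal_chiSum_diff_le {w v r : ℕ → ℝ} (hv : ∀ k, 0 ≤ v k) (hr : ∀ k, 0 ≤ r k)
    (hw : ∀ k, w k = v k + r k) {w₀ : ℝ} (hw₀ : 0 ≤ w₀) {F : Finset ℕ} (hF : ∀ k ∈ F, w₀ ≤ w k)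
    {e τ x : ℝ} (hx : 0 ≤ x) (hτ : 0 < τ) (he0 : 0 ≤ e)
    (he : ∑' k, ENNReal.ofReal (r k) ≤ ENNReal.ofReal e) :
    stdNoise.real ({z | chiSum v z ≤ ENNReal.ofReal x} \ {z | chiSum w z ≤ ENNReal.ofReal x}) ≤
      concBound F.card (w₀ / τ) + e / τ := by
  have hadd : ∀ z, chiSum w z = chiSum v z + chiSum r z := by
    intro z
    unfold chiSum
    rw [← ENNReal.tsum_add]
    refine tsum_congr fun k => ?_
    rw [hw, add_mul, ENNReal.ofReal_add (mul_nonneg (hv k) (sq_nonneg _))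
      (mul_nonneg (hr k) (sq_nonneg _))]
  -- If `v` gives a value at most `x` and `w = v + r` one above `x`, then either the remainder is at
  -- least `τ`, handled by Markov's inequality, or the `w`-sum falls in the window between `x` and
  -- `x + τ`, handled by anti-concentration.
  have hsub : {z | chiSum v z ≤ ENNReal.ofReal x} \ {z | chiSum w z ≤ ENNReal.ofReal x} ⊆
      {z | chiSum w z ≠ ∞ ∧ |(chiSum w z).toReal - x| ≤ τ} ∪
        {z | ENNReal.ofReal τ ≤ chiSum r z} := by
    rintro z ⟨h1, h2⟩
    by_cases h3 : ENNReal.ofReal τ ≤ chiSum r z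
    · exact Or.inr h3
    left
    simp only [mem_ofPred_eq, not_le] at h1 h2 h3
    have h4 : chiSum w z ≤ ENNReal.ofReal (x + τ) := by
      rw [hadd, ENNReal.ofReal_add hx hτ.le]
      exact add_le_add h1 h3.le
    have h5 : chiSum w z ≠ ∞ := (h4.trans_lt ENNReal.ofReal_lt_top).ne
    refine ⟨h5, abs_le.2 ⟨?_, ?_⟩⟩
    · have := (ENNReal.ofReal_lt_iff_lt_toReal hx h5).1 h2
      linarith
    · have := ENNReal.toReal_le_of_le_ofReal (by positivity) h4
      linarith
  refine (measureReal_mono hsub).trans ((measureReal_union_le _ _).trans (add_le_add ?_ ?_))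
  · exact measureReal_chiSum_le (fun k => by rw [hw]; exact add_nonneg (hv k) (hr k)) hw₀ hF x hτ
  · rw [measureReal_def]
    refine ENNReal.toReal_le_of_le_ofReal (by positivity) ?_
    rw [ENNReal.ofReal_div_of_pos hτ]
    refine (meas_ge_le_lintegral_div (measurable_chiSum r).aemeasurable
      (by simpa using hτ) ENNReal.ofReal_ne_top).trans ?_
    rw [lintegral_chiSum hr]
    gcongr

/-- Exact independence of slightly larger events passes to the original ones, at the cost of the two
excess probabilities. -/
lemma abs_measureReal_inter_sub_mul_le {Ω : Type*} [MeasurableSpace Ω] (μ : Measure Ω)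
    [IsProbabilityMeasure μ] {A A' B B' : Set Ω} (hA : A ⊆ A') (hB : B ⊆ B')
    (hAm : MeasurableSet A) (hBm : MeasurableSet B)
    (hind : μ.real (A' ∩ B') = μ.real A' * μ.real B') :
    |μ.real (A ∩ B) - μ.real A * μ.real B| ≤ μ.real (A' \ A) + μ.real (B' \ B) := by
  have a1 : μ.real (A' \ A) = μ.real A' - μ.real A := measureReal_sdiff hA hAm
  have b1 : μ.real (B' \ B) = μ.real B' - μ.real B := measureReal_sdiff hB hBm
  have h1 : μ.real (A ∩ B) ≤ μ.real (A' ∩ B') := measureReal_mono (inter_subset_inter hA hB)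
  have h2 : μ.real (A' ∩ B') ≤ μ.real (A ∩ B) + (μ.real (A' \ A) + μ.real (B' \ B)) := by
    have : A' ∩ B' ⊆ (A ∩ B) ∪ ((A' \ A) ∪ (B' \ B)) := by
      rintro z ⟨h1, h2⟩
      by_cases h3 : z ∈ A <;> by_cases h4 : z ∈ B <;> simp [*]
    refine (measureReal_mono this).trans ((measureReal_union_le _ _).trans ?_)
    gcongr
    exact measureReal_union_le _ _
  have h3 : μ.real A ≤ μ.real A' := measureReal_mono hA
  have h4 : μ.real B ≤ μ.real B' := measureReal_mono hB
  have p1 : μ.real A' ≤ 1 := measureReal_le_one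
  have p2 : μ.real B ≤ 1 := measureReal_le_one
  have p3 : 0 ≤ μ.real A := measureReal_nonneg
  have p4 : 0 ≤ μ.real B := measureReal_nonneg
  rw [abs_le]
  constructor <;> nlinarith

/-- Two weighted chi-square variables are approximately independent if the first one is
dominated by the coordinates in `S` and the second one by those outside `S`. -/
lemma abs_chiSum_inter_sub_mul_le {w v : ℕ → ℝ} (hw : ∀ k, 0 ≤ w k) (hv : ∀ k, 0 ≤ v k)
    {w₀ v₀ : ℝ} (hw₀ : 0 ≤ w₀) (hv₀ : 0 ≤ v₀) {F G S : Finset ℕ} (hF : ∀ k ∈ F, w₀ ≤ w k)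
    (hG : ∀ k ∈ G, v₀ ≤ v k) {x y τ M e m : ℝ} (hx : 0 ≤ x) (hy : 0 ≤ y) (hτ : 0 < τ) (hM : 0 < M)
    (he0 : 0 ≤ e) (he : ∑' k, ENNReal.ofReal (if k ∈ S then 0 else w k) ≤ ENNReal.ofReal e)
    (hm : ∑ k ∈ S, v k ≤ m) :
    |stdNoise.real ({z | chiSum w z ≤ ENNReal.ofReal x} ∩ {z | chiSum v z ≤ ENNReal.ofReal y}) -
      stdNoise.real {z | chiSum w z ≤ ENNReal.ofReal x} *
        stdNoise.real {z | chiSum v z ≤ ENNReal.ofReal y}| ≤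
      (concBound F.card (w₀ / τ) + e / τ) + (concBound G.card (v₀ / M) + m / M) := by
  have hm0 : 0 ≤ m := (Finset.sum_nonneg fun k _ => hv k).trans hm
  have hmono : ∀ {a b : ℕ → ℝ} (z : ℕ → ℝ), (∀ k, a k ≤ b k) → chiSum a z ≤ chiSum b z := by
    intro a b z h
    exact ENNReal.tsum_le_tsum fun k => ENNReal.ofReal_le_ofReal
      (mul_le_mul_of_nonneg_right (h k) (sq_nonneg _))
  -- The first sum keeps only the coordinates in `S` and the second only those outside. Deleting
  -- weights lowers the sums, hence enlarges both sublevel sets.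
  have hind := indepFun_chiSum (w := fun k => if k ∈ S then w k else 0)
    (w' := fun k => if k ∈ S then 0 else v k) (fun k => by by_cases hk : k ∈ S <;> simp [hk])
  have hind' := congrArg ENNReal.toReal (hind.measure_inter_preimage_eq_mul
    (Iic (ENNReal.ofReal x)) (Iic (ENNReal.ofReal y)) measurableSet_Iic measurableSet_Iic)
  rw [ENNReal.toReal_mul] at hind'
  refine (abs_measureReal_inter_sub_mul_le stdNoise
    (A' := {z | chiSum (fun k => if k ∈ S then w k else 0) z ≤ ENNReal.ofReal x})
    (B' := {z | chiSum (fun k => if k ∈ S then 0 else v k) z ≤ ENNReal.ofReal y})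
    ?_ ?_ (measurableSet_chiSum_le _ _) (measurableSet_chiSum_le _ _) hind').trans
    (add_le_add ?_ ?_)
  · exact fun z hz => (hmono z fun k => by by_cases hk : k ∈ S <;> simp [hk, hw]).trans hz
  · exact fun z hz => (hmono z fun k => by by_cases hk : k ∈ S <;> simp [hk, hv]).trans hz
  · exact measureReal_chiSum_diff_le (r := fun k => if k ∈ S then 0 else w k)
      (fun k => by by_cases hk : k ∈ S <;> simp [hk, hw])
      (fun k => by by_cases hk : k ∈ S <;> simp [hk, hw])
      (fun k => by by_cases hk : k ∈ S <;> simp [hk]) hw₀ hF hx hτ he0 he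
  · refine measureReal_chiSum_diff_le (r := fun k => if k ∈ S then v k else 0)
      (fun k => by by_cases hk : k ∈ S <;> simp [hk, hv])
      (fun k => by by_cases hk : k ∈ S <;> simp [hk, hv])
      (fun k => by by_cases hk : k ∈ S <;> simp [hk]) hv₀ hG hy hM hm0 ?_
    rw [tsum_eq_sum (s := S) (fun k hk => by simp [hk]),
      ← ENNReal.ofReal_sum_of_nonneg fun k _ => by by_cases hk : k ∈ S <;> simp [hk, hv]]
    refine ENNReal.ofReal_le_ofReal (le_trans (le_of_eq ?_) hm)
    exact Finset.sum_congr rfl fun k hk => by simp [hk]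

/-! ### Existence of quantiles -/

/-- The quantiles of a summable weighted chi-square variable exist. -/
lemma exists_chiSum_quantile {w : ℕ → ℝ} (hw : ∀ k, 0 ≤ w k) (hs : Summable w) (h0 : 0 < w 0)
    {p : ℝ} (hp : p ∈ Ioo (0 : ℝ) 1) :
    ∃ x : ℝ, 0 ≤ x ∧ stdNoise.real {z | chiSum w z ≤ ENNReal.ofReal x} = p := by
  set ν := stdNoise.map fun z => (chiSum w z).toReal with hν
  have hmeas : Measurable fun z => (chiSum w z).toReal := (measurable_chiSum w).ennreal_toReal
  have hprob : IsProbabilityMeasure ν := Measure.isProbabilityMeasure_map hmeas.aemeasurable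
  have hconc : ∀ x M : ℝ, 0 < M → ν.real {s | |s - x| ≤ M} ≤ concBound 1 (w 0 / M) := by
    intro x M hM
    rw [hν, map_measureReal_apply hmeas (measurableSet_le (by fun_prop) measurable_const)]
    refine le_trans (le_of_eq ?_) (measureReal_chiSum_le hw h0.le (F := {0})
      (fun k hk => by rw [Finset.mem_singleton.1 hk]) x hM)
    refine measureReal_congr ?_
    filter_upwards [chiSum_ne_top_ae hw hs] with z hz
    exact propext ⟨fun h => ⟨hz, h⟩, fun h => h.2⟩
  -- Coordinate 0 alone gives a modulus of continuity for the distribution function, so the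
  -- intermediate value theorem produces every level in `(0, 1)`.
  have hcont : Continuous (cdf ν) := by
    have hlim : Tendsto (fun M => concBound 1 (w 0 / M)) (𝓝[>] 0) (𝓝 0) :=
      tendsto_concBound_scale.comp (tendsto_inv_nhdsGT_zero.const_mul_atTop h0)
    rw [Metric.continuous_iff]
    intro x ε hε
    obtain ⟨M, hM1, hM⟩ := ((hlim.eventually (gt_mem_nhds hε)).and self_mem_nhdsWithin).exists
    have hM : 0 < M := hM
    have hone : ∀ a b : ℝ, a ≤ b → b - a ≤ M → cdf ν b - cdf ν a ≤ concBound 1 (w 0 / M) := by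
      intro a b hab hb
      rw [cdf_eq_real, cdf_eq_real, ← measureReal_sdiff (Iic_subset_Iic.2 hab) measurableSet_Iic]
      refine (measureReal_mono ?_).trans (hconc a M hM)
      rintro s ⟨h1, h2⟩
      simp only [mem_Iic, not_le] at h1 h2
      change |s - a| ≤ M
      exact abs_le.2 ⟨by linarith, by linarith⟩
    refine ⟨M, hM, fun y hy => ?_⟩
    rw [Real.dist_eq] at hy ⊢
    rw [abs_lt] at hy
    refine lt_of_le_of_lt ?_ hM1
    rcases le_total x y with h | h
    · rw [abs_of_nonneg (sub_nonneg.2 (monotone_cdf ν h))]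
      exact hone x y h (by linarith)
    · rw [abs_of_nonpos (sub_nonpos.2 (monotone_cdf ν h)), neg_sub]
      exact hone y x h (by linarith)
  obtain ⟨x, hx⟩ := mem_range_of_exists_le_of_exists_ge hcont
    (((tendsto_cdf_atBot ν).eventually (gt_mem_nhds hp.1)).exists.imp fun _ h => h.le)
    (((tendsto_cdf_atTop ν).eventually (lt_mem_nhds hp.2)).exists.imp fun _ h => h.le)
  rw [cdf_eq_real, hν, map_measureReal_apply hmeas measurableSet_Iic] at hx
  have hx0 : 0 ≤ x := by
    by_contra hneg
    have : (fun z => (chiSum w z).toReal) ⁻¹' Iic x = ∅ := by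
      ext z
      simp only [mem_preimage, mem_Iic, mem_empty_iff_false, iff_false, not_le]
      exact (not_le.1 hneg).trans_le ENNReal.toReal_nonneg
    rw [this] at hx
    simp at hx
    exact hp.1.ne hx
  refine ⟨x, hx0, ?_⟩
  rw [← hx]
  refine measureReal_congr ?_
  filter_upwards [chiSum_ne_top_ae hw hs] with z hz
  exact propext (ENNReal.le_ofReal_iff_toReal_le hz hx0)

/-! ### Power sums and the `H(δ)` weights -/

/-- This is the comparison of `x ^ (-1 - s)` with its integral over a unit interval, derived here
from `1 + u ≤ exp u`. The right side telescopes, and the explicit `1 / s` is what produces the sharp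
constant `1 / (2 r₁)` later. -/
lemma one_div_add_one_rpow_le {s : ℝ} (hs : 0 < s) {x : ℝ} (hx : 0 < x) :
    (x + 1) ^ (-1 - s) ≤ (x ^ (-s) - (x + 1) ^ (-s)) / s := by
  rw [le_div_iff₀ hs]
  have h1 : (0 : ℝ) < x + 1 := by linarith
  have e1 : (x + 1) ^ (-1 - s) = (x + 1) ^ (-s) * (x + 1)⁻¹ := by
    rw [← Real.rpow_neg_one, ← Real.rpow_add h1]
    congr 1
    ring
  have e2 : x ^ (-s) = (x + 1) ^ (-s) * Real.exp (-s * Real.log (x / (x + 1))) := by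
    rw [Real.rpow_def_of_pos hx, Real.rpow_def_of_pos h1, ← Real.exp_add,
      Real.log_div hx.ne' h1.ne']
    congr 1
    ring
  have h2 : Real.log (x / (x + 1)) ≤ -(x + 1)⁻¹ := by
    have := Real.log_le_sub_one_of_pos (x := x / (x + 1)) (by positivity)
    refine this.trans (le_of_eq ?_)
    field_simp
    ring
  have h3 : 1 + s * (x + 1)⁻¹ ≤ Real.exp (-s * Real.log (x / (x + 1))) := by
    have := Real.add_one_le_exp (-s * Real.log (x / (x + 1)))
    nlinarith
  have h4 : 0 < (x + 1) ^ (-s) := by positivity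
  rw [e1, e2]
  nlinarith

lemma sum_range_rpow_le {s : ℝ} (hs : 0 < s) (N : ℕ) :
    ∑ k ∈ Finset.range (N + 1), ((k : ℝ) + 1) ^ (-1 - s) ≤
      1 + (1 - ((N : ℝ) + 1) ^ (-s)) / s := by
  induction N with
  | zero => simp
  | succ N ih =>
    rw [Finset.sum_range_succ]
    have := one_div_add_one_rpow_le hs (x := (N : ℝ) + 1) (by positivity)
    push_cast at this ⊢
    refine (add_le_add ih this).trans (le_of_eq ?_)
    ring

/-- A comparison of `∑ k ^ (-1 - s)` with the corresponding integral. -/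
lemma sum_rpow_le {s : ℝ} (hs : 0 < s) (S : Finset ℕ) :
    ∑ k ∈ S, ((k : ℝ) + 1) ^ (-1 - s) ≤ 1 + 1 / s := by
  obtain ⟨N, hN⟩ := S.exists_nat_subset_range
  refine (Finset.sum_le_sum_of_subset_of_nonneg (hN.trans (Finset.range_mono (Nat.le_succ N)))
    fun k _ _ => by positivity).trans ((sum_range_rpow_le hs N).trans ?_)
  gcongr
  have : 0 ≤ ((N : ℝ) + 1) ^ (-s) := by positivity
  linarith

/-- The weights of the squared `H(δ)`-norm. -/
def hNormWeight (δ : ℝ) (k : ℕ) : ℝ :=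
  ((k : ℝ) + 1) ^ (2 * (-1 / 2) : ℝ) * Real.log (max ((k : ℝ) + 1) 2) ^ (-2 * δ)

lemma log_max_pos (x : ℝ) : 0 < Real.log (max x 2) :=
  Real.log_pos (lt_of_lt_of_le (by norm_num) (le_max_right x 2))

lemma hNormWeight_pos (δ : ℝ) (k : ℕ) : 0 < hNormWeight δ k :=
  mul_pos (by positivity) (Real.rpow_pos_of_pos (log_max_pos _) _)

/-- Cauchy condensation reduces `∑ 1 / (k (log k) ^ (2 δ))` to `∑ k ^ (-2 δ)`, whence the threshold
`δ > 1 / 2`. -/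
lemma summable_hNormWeight {δ : ℝ} (hδ : 1 / 2 < δ) : Summable (hNormWeight δ) := by
  set f : ℕ → ℝ := fun k => (k : ℝ)⁻¹ * Real.log (max (k : ℝ) 2) ^ (-2 * δ) with hf
  have hfs : Summable f := by
    refine (summable_condensed_iff_of_nonneg (fun k => ?_) fun m n hm hmn => ?_).1 ?_
    · exact mul_nonneg (by positivity) (Real.rpow_nonneg (log_max_pos _).le _)
    · have hm' : (0 : ℝ) < m := by exact_mod_cast hm
      have hmn' : (m : ℝ) ≤ n := by exact_mod_cast hmn
      refine mul_le_mul ?_ ?_ (Real.rpow_nonneg (log_max_pos _).le _) (by positivity)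
      · gcongr
      · refine Real.rpow_le_rpow_of_nonpos (log_max_pos _) ?_ (by linarith)
        exact Real.log_le_log (lt_of_lt_of_le (by norm_num) (le_max_right _ 2))
          (max_le_max_right _ hmn')
    · rw [← summable_nat_add_iff 1]
      have h1 : Summable fun k : ℕ => Real.log 2 ^ (-2 * δ) * ((k + 1 : ℕ) : ℝ) ^ (-2 * δ) :=
        ((summable_nat_add_iff 1).2 (Real.summable_nat_rpow.2 (by linarith))).mul_left _
      refine h1.congr fun k => ?_
      have h2 : (2 : ℝ) ≤ 2 ^ (k + 1) := by
        calc (2 : ℝ) = 2 ^ 1 := by norm_num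
          _ ≤ 2 ^ (k + 1) := by gcongr <;> norm_num
      simp only [hf]
      push_cast
      rw [max_eq_left h2, Real.log_pow, Real.mul_rpow (by positivity)
        (Real.log_nonneg (by norm_num))]
      push_cast
      field_simp
  refine ((summable_nat_add_iff 1).2 hfs).congr fun k => ?_
  simp only [hf, hNormWeight]
  push_cast
  congr 1
  rw [← Real.rpow_neg_one]
  norm_num

/-! ### The posterior in normalized coordinates -/

/-- The variance of the `k`-th coordinate under the posterior. -/
def postVar (n : ℕ) (α : ℝ) (k : ℕ) : ℝ := 1 / (((k : ℝ) + 1) ^ (2 * α + 1) + n)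

lemma postVar_pos (n : ℕ) (α : ℝ) (k : ℕ) : 0 < postVar n α k := by
  unfold postVar; positivity

/-- The normalized deviation from the posterior mean. -/
def normalizedDev (n : ℕ) (α : ℝ) (y f : ℕ → ℝ) (k : ℕ) : ℝ :=
  (f k - posteriorMean n α y k) / √(postVar n α k).toNNReal

lemma measurable_normalizedDev (n : ℕ) (α : ℝ) (y : ℕ → ℝ) : Measurable (normalizedDev n α y) := by
  unfold normalizedDev
  fun_prop

instance (n : ℕ) (α : ℝ) (y : ℕ → ℝ) : IsProbabilityMeasure (posterior n α y) := by
  unfold posterior; infer_instance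

/-- The right side does not involve `y`, so bounds uniform in the remaining parameters may be
applied with data-dependent `α` and radii. -/
lemma posterior_real_preimage (n : ℕ) (α : ℝ) (y : ℕ → ℝ) {A : Set (ℕ → ℝ)}
    (hA : MeasurableSet A) :
    (posterior n α y).real (normalizedDev n α y ⁻¹' A) = stdNoise.real A := by
  rw [← map_infinitePi_gaussianReal (posteriorMean n α y) (fun k => (postVar n α k).toNNReal)
    (fun k => by simpa using postVar_pos n α k)]
  exact (map_measureReal_apply (measurable_normalizedDev n α y) hA).symm

lemma weightedNorm_le_iff (c : ℕ → ℝ) (n : ℕ) (α : ℝ) (y f : ℕ → ℝ) {r : ℝ} (hr : 0 ≤ r) :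
    (∑' k, ENNReal.ofReal (c k * (f - posteriorMean n α y) k ^ 2)) ^ (1 / 2 : ℝ) ≤
      ENNReal.ofReal r ↔
    chiSum (fun k => c k * postVar n α k) (normalizedDev n α y f) ≤ ENNReal.ofReal (r ^ 2) := by
  rw [one_div, ENNReal.rpow_inv_le_iff (by norm_num),
    ENNReal.ofReal_rpow_of_nonneg hr (by norm_num), Real.rpow_two]
  have : ∀ k, c k * (f - posteriorMean n α y) k ^ 2 =
      c k * postVar n α k * normalizedDev n α y f k ^ 2 := by
    intro k
    have h := postVar_pos n α k
    rw [normalizedDev, div_pow, Real.sq_sqrt (NNReal.coe_nonneg _), Real.coe_toNNReal _ h.le,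
      Pi.sub_apply]
    field_simp
  simp_rw [this]
  rfl

lemma hBall_eq (n : ℕ) (α δ : ℝ) {ρ : ℝ} (hρ : 0 ≤ ρ) (y : ℕ → ℝ) :
    hBall n α δ ρ y = normalizedDev n α y ⁻¹'
      {z | chiSum (fun k => hNormWeight δ k * postVar n α k) z ≤ ENNReal.ofReal ((ρ / √n) ^ 2)} := by
  ext f
  exact weightedNorm_le_iff (hNormWeight δ) n α y f (by positivity)

lemma l2Ball_eq (n : ℕ) (α : ℝ) {q : ℝ} (hq : 0 ≤ q) (y : ℕ → ℝ) :
    l2Ball n α q y = normalizedDev n α y ⁻¹'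
      {z | chiSum (postVar n α) z ≤ ENNReal.ofReal (q ^ 2)} := by
  ext f
  have := weightedNorm_le_iff (fun _ => 1) n α y f hq
  simp only [one_mul] at this
  exact this

/-- The ball of the Sobolev space `H^s` around the posterior mean. -/
def sobolevBall (n : ℕ) (α s r : ℝ) (y : ℕ → ℝ) : Set (ℕ → ℝ) :=
  {f | sobolevNorm s (f - posteriorMean n α y) ≤ ENNReal.ofReal r}

lemma sobolevBall_eq (n : ℕ) (α s : ℝ) {r : ℝ} (hr : 0 ≤ r) (y : ℕ → ℝ) :
    sobolevBall n α s r y = normalizedDev n α y ⁻¹'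
      {z | chiSum (fun k => ((k : ℝ) + 1) ^ (2 * s) * postVar n α k) z ≤
        ENNReal.ofReal (r ^ 2)} := by
  ext f
  have := weightedNorm_le_iff (fun k => ((k : ℝ) + 1) ^ (2 * s)) n α y f hr
  simp only [sobolevBall, sobolevNorm, sobolevLogNorm, mem_ofPred_eq, mul_zero, Real.rpow_zero,
    mul_one]
  exact this

lemma natCast_mul_postVar_le_one (n : ℕ) (α : ℝ) (k : ℕ) : n * postVar n α k ≤ 1 := by
  unfold postVar
  rw [mul_one_div, div_le_one (by positivity)]
  have : 0 ≤ ((k : ℝ) + 1) ^ (2 * α + 1) := by positivity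
  linarith

lemma half_le_natCast_mul_postVar {n : ℕ} {α : ℝ} {k : ℕ}
    (h : ((k : ℝ) + 1) ^ (2 * α + 1) ≤ n) : 1 / 2 ≤ n * postVar n α k := by
  have h0 : 0 < ((k : ℝ) + 1) ^ (2 * α + 1) := by positivity
  unfold postVar
  rw [mul_one_div, div_le_div_iff₀ (by norm_num) (by positivity)]
  linarith

/-! ### Posterior probabilities of the balls -/

/-- Under the posterior the `H(δ)`-norm and the `ℓ₂`-norm of the deviation from the mean are
asymptotically independent. -/
theorem eventually_abs_posterior_inter_le {δ : ℝ} (hδ : 1 / 2 < δ) {a : ℕ → ℝ}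
    (ha : a =o[atTop] (fun n : ℕ => Real.log n)) {η : ℝ} (hη : 0 < η) :
    ∀ᶠ n : ℕ in atTop, ∀ (α ρ q : ℝ) (y : ℕ → ℝ), 0 ≤ α → α ≤ a n → 0 ≤ ρ → 0 ≤ q →
      |(posterior n α y).real (hBall n α δ ρ y ∩ l2Ball n α q y) -
        (posterior n α y).real (hBall n α δ ρ y) * (posterior n α y).real (l2Ball n α q y)| ≤ η := by
  set u := hNormWeight δ with hu
  have hu0 : ∀ k, 0 < u k := hNormWeight_pos δ
  have hus : Summable u := summable_hNormWeight hδ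
  have hη4 : 0 < η / 4 := by linarith
  -- The choices are successive, each costing `η / 4`. At scale `τ / n` coordinate 0 already smooths
  -- the `H(δ)`-norm; `S` carries all but `η τ / 4` of the weights; `M / n` dominates the mean
  -- `S.card / n` of the part removed from the `ℓ₂`-norm; `N` coordinates smooth the `ℓ₂`-norm at
  -- scale `M / n`.
  obtain ⟨τ, hτ1, hτ⟩ : ∃ τ : ℝ, concBound 1 (u 0 / 2 / τ) < η / 4 ∧ 0 < τ := by
    have hlim : Tendsto (fun τ => concBound 1 (u 0 / 2 / τ)) (𝓝[>] 0) (𝓝 0) :=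
      tendsto_concBound_scale.comp (tendsto_inv_nhdsGT_zero.const_mul_atTop (half_pos (hu0 0)))
    exact ((hlim.eventually (gt_mem_nhds hη4)).and self_mem_nhdsWithin).exists
  obtain ⟨S, hS⟩ : ∃ S : Finset ℕ, ∑' k, (if k ∈ S then 0 else u k) < η / 4 * τ := by
    have h1 := tendsto_tsum_compl_atTop_zero u
    obtain ⟨S, hS⟩ := (h1.eventually (gt_mem_nhds (mul_pos hη4 hτ))).exists
    refine ⟨S, lt_of_le_of_lt (le_of_eq ?_) hS⟩
    refine Eq.trans (tsum_congr ?_) (tsum_subtype {x | x ∉ S} u).symm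
    intro k
    by_cases hk : k ∈ S <;> simp [hk]
  obtain ⟨M, hM1, hM⟩ : ∃ M : ℝ, S.card / M ≤ η / 4 ∧ 0 < M := by
    refine ⟨(S.card + 1) / (η / 4), ?_, by positivity⟩
    rw [div_div_eq_mul_div, div_le_iff₀ (by positivity)]
    nlinarith
  obtain ⟨N, hN⟩ : ∃ N : ℕ, concBound N (1 / 2 / M) < η / 4 :=
    ((tendsto_concBound_card (s := 1 / 2 / M) (by positivity)).eventually
      (gt_mem_nhds hη4)).exists
  -- This says `(N + 1) ^ (2 a n + 1) ≤ n`, so that the first `N` posterior variances are at least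
  -- `1 / (2 n)` for every `α ≤ a n`; it is the only use of `a = o(log n)`. One half of `log n`
  -- absorbs `2 a n log (N + 1)`, the other half the remaining `log (N + 1)`.
  have hlog : ∀ᶠ n : ℕ in atTop, (2 * a n + 1) * Real.log (N + 1) ≤ Real.log n := by
    have hc : 0 < 1 / (4 * (Real.log (N + 1) + 1)) := by
      have : 0 ≤ Real.log ((N : ℝ) + 1) := Real.log_nonneg (by linarith [N.cast_nonneg (α := ℝ)])
      positivity
    have hL : Tendsto (fun n : ℕ => Real.log n) atTop atTop :=
      Real.tendsto_log_atTop.comp tendsto_natCast_atTop_atTop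
    filter_upwards [ha.bound hc, hL.eventually_ge_atTop (2 * Real.log (N + 1)),
      hL.eventually_ge_atTop 0] with n h1 h2 h3
    have hN0 : 0 ≤ Real.log ((N : ℝ) + 1) := Real.log_nonneg (by linarith [N.cast_nonneg (α := ℝ)])
    rw [Real.norm_eq_abs, Real.norm_of_nonneg h3] at h1
    have h4 : a n ≤ 1 / (4 * (Real.log (N + 1) + 1)) * Real.log n := (le_abs_self _).trans h1
    have h5 : 4 * (a n * (Real.log (N + 1))) ≤ Real.log n := by
      have h6 : 4 * a n * (Real.log (N + 1) + 1) ≤ Real.log n := by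
        rw [div_mul_eq_mul_div, one_mul, le_div_iff₀ (by positivity)] at h4
        linarith
      rcases le_total 0 (a n) with h | h
      · linarith
      · have := mul_nonpos_of_nonpos_of_nonneg h hN0
        linarith
    linarith
  filter_upwards [hlog, eventually_ge_atTop 1] with n hn hn1 α ρ q y hα0 hα hρ hq
  have hn0 : (1 : ℝ) ≤ n := by exact_mod_cast hn1
  have hnpos : (0 : ℝ) < n := by linarith
  rw [hBall_eq n α δ hρ, l2Ball_eq n α hq, ← preimage_inter,
    posterior_real_preimage _ _ _ ((measurableSet_chiSum_le _ _).inter (measurableSet_chiSum_le _ _)),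
    posterior_real_preimage _ _ _ (measurableSet_chiSum_le _ _),
    posterior_real_preimage _ _ _ (measurableSet_chiSum_le _ _)]
  have hw1 : ∀ k, u k * postVar n α k ≤ u k / n := by
    intro k
    rw [le_div_iff₀ hnpos]
    have := natCast_mul_postVar_le_one n α k
    nlinarith [hu0 k]
  have hs2 : Summable fun k => if k ∈ S then 0 else u k := by
    refine hus.of_nonneg_of_le (fun k => ?_) fun k => ?_ <;> by_cases hk : k ∈ S <;>
      simp [hk, (hu0 k).le]
  refine (abs_chiSum_inter_sub_mul_le (F := {0}) (G := Finset.range N) (S := S)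
    (w₀ := u 0 / 2 / n) (v₀ := 1 / 2 / n) (τ := τ / n) (M := M / n) (e := η / 4 * τ / n)
    (m := S.card / n)
    (fun k => mul_nonneg (hu0 k).le (postVar_pos n α k).le) (fun k => (postVar_pos n α k).le)
    (by have := hu0 0; positivity) (by positivity) ?_ ?_ (by positivity) (by positivity)
    (by positivity) (by positivity) (by positivity) ?_ ?_).trans ?_
  · intro k hk
    rw [Finset.mem_singleton.1 hk, div_le_iff₀ hnpos]
    have := half_le_natCast_mul_postVar (n := n) (α := α) (k := 0) (by simpa using hn0)
    nlinarith [hu0 0]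
  · intro k hk
    rw [div_le_iff₀ hnpos, mul_comm]
    refine half_le_natCast_mul_postVar ?_
    have hk1 : (k : ℝ) + 1 ≤ N + 1 := by
      have : k ≤ N := (Finset.mem_range.1 hk).le
      exact_mod_cast Nat.add_le_add_right this 1
    have hN1 : (1 : ℝ) ≤ N + 1 := by linarith [N.cast_nonneg (α := ℝ)]
    calc ((k : ℝ) + 1) ^ (2 * α + 1) ≤ ((N : ℝ) + 1) ^ (2 * α + 1) := by gcongr
      _ ≤ ((N : ℝ) + 1) ^ (2 * a n + 1) := Real.rpow_le_rpow_of_exponent_le hN1 (by linarith)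
      _ ≤ n := by
        rw [Real.rpow_def_of_pos (by linarith), mul_comm]
        exact (Real.le_log_iff_exp_le hnpos).1 hn
  · calc ∑' k, ENNReal.ofReal (if k ∈ S then 0 else u k * postVar n α k)
        ≤ ∑' k, ENNReal.ofReal ((if k ∈ S then 0 else u k) / n) := by
          refine ENNReal.tsum_le_tsum fun k => ENNReal.ofReal_le_ofReal ?_
          by_cases hk : k ∈ S
          · simp [hk]
          · simpa [hk] using hw1 k
      _ = ENNReal.ofReal (∑' k, (if k ∈ S then 0 else u k) / n) := by
          rw [ENNReal.ofReal_tsum_of_nonneg (fun k => ?_) (hs2.div_const _)]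
          by_cases hk : k ∈ S
          · simp [hk]
          · simpa [hk] using div_nonneg (hu0 k).le hnpos.le
      _ ≤ _ := by
          rw [tsum_div_const]
          exact ENNReal.ofReal_le_ofReal (by gcongr)
  · calc ∑ k ∈ S, postVar n α k ≤ ∑ k ∈ S, 1 / (n : ℝ) := by
          refine Finset.sum_le_sum fun k _ => ?_
          rw [le_div_iff₀ hnpos, mul_comm]
          exact natCast_mul_postVar_le_one n α k
      _ = _ := by rw [Finset.sum_const, nsmul_eq_mul, mul_one_div]
  · rw [div_div_div_cancel_right₀ hnpos.ne', div_div_div_cancel_right₀ hnpos.ne',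
      div_div_div_cancel_right₀ hnpos.ne', div_div_div_cancel_right₀ hnpos.ne',
      mul_div_cancel_right₀ _ hτ.ne', Finset.card_singleton, Finset.card_range]
    linarith

/-- The Sobolev ball has posterior probability tending to one. -/
theorem eventually_posterior_compl_sobolevBall_le {r₁ C : ℝ} (hr₁ : 0 < r₁) (hC : 0 < C)
    (hCr : 1 / (2 * r₁) < C ^ 2) {η : ℝ} (hη : 0 < η) :
    ∀ᶠ n : ℕ in atTop, ∀ (α ε : ℝ) (y : ℕ → ℝ), r₁ / Real.log n ≤ ε →
      (posterior n α y).real (sobolevBall n α (α - ε) (C * √(Real.log n)) y)ᶜ ≤ η := by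
  have hL : Tendsto (fun n : ℕ => Real.log n) atTop atTop :=
    Real.tendsto_log_atTop.comp tendsto_natCast_atTop_atTop
  -- This is the gap, per unit of `log n`, between the squared radius and the bound on the mean.
  set c := C ^ 2 - 1 / (2 * r₁) with hc
  have hc0 : 0 < c := by linarith
  have hT : Tendsto (fun n : ℕ => c * Real.log n - 1) atTop atTop :=
    tendsto_atTop_add_const_right _ _ (hL.const_mul_atTop hc0)
  have hlim : Tendsto (fun n : ℕ => sqVar * 2 / (c * Real.log n - 1) ^ 2) atTop (𝓝 0) :=
    ((tendsto_pow_atTop (by norm_num)).comp hT).const_div_atTop _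
  filter_upwards [hL.eventually_gt_atTop 0, hT.eventually_gt_atTop 0,
    hlim.eventually (gt_mem_nhds hη)] with n h1 h2 h3 α ε y hε
  have hε0 : 0 < ε := lt_of_lt_of_le (by positivity) hε
  rw [sobolevBall_eq n α _ (by positivity), ← preimage_compl,
    posterior_real_preimage _ _ _ (measurableSet_chiSum_le _ _).compl]
  have hw : ∀ k : ℕ, ((k : ℝ) + 1) ^ (2 * (α - ε)) * postVar n α k ≤
      ((k : ℝ) + 1) ^ (-1 - 2 * ε) := by
    intro k
    have hk : (0 : ℝ) < (k : ℝ) + 1 := by positivity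
    have hp : postVar n α k ≤ ((k : ℝ) + 1) ^ (-(2 * α + 1)) := by
      rw [Real.rpow_neg hk.le, ← one_div]
      unfold postVar
      gcongr
      linarith [n.cast_nonneg (α := ℝ)]
    calc ((k : ℝ) + 1) ^ (2 * (α - ε)) * postVar n α k ≤
        ((k : ℝ) + 1) ^ (2 * (α - ε)) * ((k : ℝ) + 1) ^ (-(2 * α + 1)) := by gcongr
      _ = _ := by
        rw [← Real.rpow_add hk]
        congr 1
        ring
  have hw0 : ∀ k : ℕ, 0 ≤ ((k : ℝ) + 1) ^ (2 * (α - ε)) * postVar n α k := fun k =>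
    mul_nonneg (by positivity) (postVar_pos n α k).le
  -- The choice of `t` makes `m + t` equal to the squared radius `C ^ 2 log n`. The squared weights
  -- are at most `k ^ (-2)` in one-based indexing, so their sum is at most 2.
  have htail := chiSum_upper_tail hw0 (m := 1 + Real.log n / (2 * r₁)) (v := 2)
    (t := c * Real.log n - 1) (fun S => ?_) (fun S => ?_) h2
  · have e : ({z | chiSum (fun k => ((k : ℝ) + 1) ^ (2 * (α - ε)) * postVar n α k) z ≤
        ENNReal.ofReal ((C * √(Real.log n)) ^ 2)} : Set (ℕ → ℝ))ᶜ =
        {z | ENNReal.ofReal (1 + Real.log n / (2 * r₁) + (c * Real.log n - 1)) <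
          chiSum (fun k => ((k : ℝ) + 1) ^ (2 * (α - ε)) * postVar n α k) z} := by
      ext z
      simp only [mem_compl_iff, mem_ofPred_eq, not_le]
      rw [mul_pow, Real.sq_sqrt h1.le, hc]
      congr! 2
      ring
    rw [e, measureReal_def]
    refine (ENNReal.toReal_le_of_le_ofReal ?_ htail).trans h3.le
    have := sqVar_nonneg
    positivity
  · refine (Finset.sum_le_sum fun k _ => hw k).trans
      ((sum_rpow_le (s := 2 * ε) (by positivity) S).trans ?_)
    have : r₁ ≤ ε * Real.log n := by rwa [div_le_iff₀ h1] at hε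
    rw [add_le_add_iff_left, div_le_div_iff₀ (by positivity) (by positivity)]
    linarith
  · have h := sum_rpow_le (s := 1) one_pos S
    refine (Finset.sum_le_sum fun k _ => ?_).trans (h.trans (by norm_num))
    have hk : (1 : ℝ) ≤ (k : ℝ) + 1 := by linarith [k.cast_nonneg (α := ℝ)]
    calc _ ≤ (((k : ℝ) + 1) ^ (-1 - 2 * ε)) ^ 2 := by
          have := hw0 k
          gcongr
          exact hw k
      _ = ((k : ℝ) + 1) ^ (2 * (-1 - 2 * ε)) := by
          rw [← Real.rpow_natCast, ← Real.rpow_mul (by positivity)]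
          congr 1
          push_cast
          ring
      _ ≤ _ := Real.rpow_le_rpow_of_exponent_le hk (by linarith)

lemma hRadii_nonempty {n : ℕ} (hn : 1 ≤ n) (α : ℝ) {δ γ : ℝ} (hδ : 1 / 2 < δ)
    (hγ : γ ∈ Ioo (0 : ℝ) 1) (y : ℕ → ℝ) : (hRadii n α δ γ y).Nonempty := by
  have hn0 : (1 : ℝ) ≤ n := by exact_mod_cast hn
  have hnpos : (0 : ℝ) < n := by linarith
  have hpos : ∀ k, 0 < hNormWeight δ k * postVar n α k := fun k =>
    mul_pos (hNormWeight_pos δ k) (postVar_pos n α k)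
  have hs : Summable fun k => hNormWeight δ k * postVar n α k := by
    refine (summable_hNormWeight hδ).of_nonneg_of_le (fun k => (hpos k).le) fun k => ?_
    have h1 := natCast_mul_postVar_le_one n α k
    have h2 := postVar_pos n α k
    have h3 := hNormWeight_pos δ k
    nlinarith
  obtain ⟨x, hx, h⟩ := exists_chiSum_quantile (fun k => (hpos k).le) hs (hpos 0) (p := 1 - γ)
    ⟨by linarith [hγ.2], by linarith [hγ.1]⟩
  refine ⟨√x * √n, by positivity, ?_⟩
  rw [hBall_eq n α δ (by positivity), posterior_real_preimage _ _ _ (measurableSet_chiSum_le _ _),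
    mul_div_cancel_right₀ _ (by positivity), Real.sq_sqrt hx, h]

lemma summable_postVar (n : ℕ) {α : ℝ} (hα : 0 < α) : Summable (postVar n α) := by
  have h : Summable fun k : ℕ => ((k + 1 : ℕ) : ℝ) ^ (-(2 * α + 1)) :=
    (summable_nat_add_iff 1).2 (Real.summable_nat_rpow.2 (by linarith))
  refine h.of_nonneg_of_le (fun k => (postVar_pos n α k).le) fun k => ?_
  rw [Real.rpow_neg (by positivity), ← one_div]
  unfold postVar
  push_cast
  gcongr
  linarith [n.cast_nonneg (α := ℝ)]

/-- Positivity of `α` makes the posterior variances summable; this is one reason why the maximizers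
must be kept away from zero. -/
lemma l2Radii_nonempty (n : ℕ) {α γ : ℝ} (hα : 0 < α) (hγ : γ ∈ Ioo (0 : ℝ) 1) (y : ℕ → ℝ) :
    (l2Radii n α γ y).Nonempty := by
  obtain ⟨x, hx, h⟩ := exists_chiSum_quantile (w := postVar n α)
    (fun k => (postVar_pos n α k).le) (summable_postVar n hα) (postVar_pos n α 0)
    (p := 1 - γ) ⟨by linarith [hγ.2], by linarith [hγ.1]⟩
  refine ⟨√x, by positivity, ?_⟩
  rw [l2Ball_eq n α (by positivity), posterior_real_preimage _ _ _ (measurableSet_chiSum_le _ _),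
    Real.sq_sqrt hx, h]

/-! ### Decomposition of the marginal likelihood -/

/-- The shrinkage factor of the posterior mean. -/
def shrink (n : ℕ) (α : ℝ) (k : ℕ) : ℝ := n / (((k : ℝ) + 1) ^ (2 * α + 1) + n)

/-- The expected contribution of the `k`-th coordinate to `-2 ℓ_n` under pure noise. -/
def noiseCost (n : ℕ) (α : ℝ) (k : ℕ) : ℝ :=
  Real.log (1 + n / ((k : ℝ) + 1) ^ (2 * α + 1)) - shrink n α k

/-- The terms of the series defining `-2 ℓ_n`. -/
def likelihoodTerm (n : ℕ) (y : ℕ → ℝ) (α : ℝ) (k : ℕ) : ℝ :=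
  Real.log (1 + n / ((k : ℝ) + 1) ^ (2 * α + 1))
    - (n : ℝ) ^ 2 / (((k : ℝ) + 1) ^ (2 * α + 1) + n) * y k ^ 2

lemma shrink_nonneg (n : ℕ) (α : ℝ) (k : ℕ) : 0 ≤ shrink n α k := by unfold shrink; positivity

lemma shrink_le_one (n : ℕ) (α : ℝ) (k : ℕ) : shrink n α k ≤ 1 := by
  unfold shrink
  rw [div_le_one (by positivity)]
  have : 0 ≤ ((k : ℝ) + 1) ^ (2 * α + 1) := by positivity
  linarith

lemma one_le_natCast_add_one (k : ℕ) : (1 : ℝ) ≤ (k : ℝ) + 1 := by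
  linarith [k.cast_nonneg (α := ℝ)]

lemma shrink_antitone (n : ℕ) {α α' : ℝ} (h : α ≤ α') (k : ℕ) :
    shrink n α' k ≤ shrink n α k := by
  unfold shrink
  have := one_le_natCast_add_one k
  gcongr

/-- Interpolation: the left side is at most `min 1 (A / B)`. Varying `θ` trades powers of `n`
against powers of `k` in all later sums. -/
lemma div_add_le_rpow {A B θ : ℝ} (hA : 0 < A) (hB : 0 < B) (h0 : 0 ≤ θ) (h1 : θ ≤ 1) :
    A / (A + B) ≤ (A / B) ^ θ := by
  rcases le_total (A / B) 1 with h | h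
  · calc A / (A + B) ≤ A / B := by gcongr; linarith
      _ = (A / B) ^ (1 : ℝ) := (Real.rpow_one _).symm
      _ ≤ (A / B) ^ θ := Real.rpow_le_rpow_of_exponent_ge (by positivity) h h1
  · calc A / (A + B) ≤ 1 := by rw [div_le_one (by positivity)]; linarith
      _ ≤ (A / B) ^ θ := Real.one_le_rpow h h0

lemma div_rpow_rpow {n x p θ : ℝ} (hn : 0 < n) (hx : 0 < x) :
    (n / x ^ p) ^ θ = n ^ θ * x ^ (-(p * θ)) := by
  rw [Real.div_rpow hn.le (by positivity), ← Real.rpow_mul hx.le, Real.rpow_neg hx.le,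
    div_eq_mul_inv]

lemma shrink_le_rpow {n : ℕ} (hn : 1 ≤ n) (α : ℝ) (k : ℕ) {θ : ℝ} (h0 : 0 ≤ θ) (h1 : θ ≤ 1) :
    shrink n α k ≤ (n : ℝ) ^ θ * ((k : ℝ) + 1) ^ (-((2 * α + 1) * θ)) := by
  have hn0 : (0 : ℝ) < n := by exact_mod_cast hn
  rw [← div_rpow_rpow hn0 (by positivity)]
  unfold shrink
  rw [add_comm]
  exact div_add_le_rpow hn0 (by positivity) h0 h1

lemma one_sub_shrink_le_rpow {n : ℕ} (hn : 1 ≤ n) (α : ℝ) (k : ℕ) {θ : ℝ} (h0 : 0 ≤ θ)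
    (h1 : θ ≤ 1) :
    1 - shrink n α k ≤ (n : ℝ) ^ (-θ) * ((k : ℝ) + 1) ^ ((2 * α + 1) * θ) := by
  have hn0 : (0 : ℝ) < n := by exact_mod_cast hn
  have hx : (0 : ℝ) < ((k : ℝ) + 1) ^ (2 * α + 1) := by positivity
  have e : 1 - shrink n α k = ((k : ℝ) + 1) ^ (2 * α + 1) / (((k : ℝ) + 1) ^ (2 * α + 1) + n) := by
    unfold shrink
    field_simp
    ring
  rw [e]
  refine (div_add_le_rpow hx hn0 h0 h1).trans (le_of_eq ?_)
  rw [Real.div_rpow hx.le hn0.le, ← Real.rpow_mul (by positivity), Real.rpow_neg hn0.le]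
  ring

lemma log_one_add_le_two_sqrt {u : ℝ} (hu : 0 ≤ u) : Real.log (1 + u) ≤ 2 * u ^ (1 / 2 : ℝ) := by
  rw [← Real.sqrt_eq_rpow]
  have h0 := Real.sqrt_nonneg u
  have h1 : Real.log (1 + u) ≤ Real.log ((1 + √u) ^ 2) := by
    apply Real.log_le_log (by positivity)
    nlinarith [Real.sq_sqrt hu]
  have h2 := Real.log_le_sub_one_of_pos (x := 1 + √u) (by positivity)
  rw [Real.log_pow] at h1
  push_cast at h1
  linarith

lemma noiseCost_eq (n : ℕ) (α : ℝ) (k : ℕ) :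
    noiseCost n α k = Real.log (1 + n / ((k : ℝ) + 1) ^ (2 * α + 1)) -
      (1 - 1 / (1 + n / ((k : ℝ) + 1) ^ (2 * α + 1))) := by
  unfold noiseCost shrink
  have : (0 : ℝ) < ((k : ℝ) + 1) ^ (2 * α + 1) := by positivity
  congr 1
  field_simp
  ring

lemma noiseCost_nonneg (n : ℕ) (α : ℝ) (k : ℕ) : 0 ≤ noiseCost n α k := by
  rw [noiseCost_eq]
  have h : (0 : ℝ) < 1 + n / ((k : ℝ) + 1) ^ (2 * α + 1) := by positivity
  have := Real.one_sub_inv_le_log_of_pos h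
  rw [one_div]
  linarith

/-- The first-order terms of `log (1 + u)` and `u / (1 + u)` cancel, so the noise costs are summable
even at `α = 0`, where neither term is on its own. -/
lemma noiseCost_le_sq (n : ℕ) (α : ℝ) (k : ℕ) :
    noiseCost n α k ≤ (n / ((k : ℝ) + 1) ^ (2 * α + 1)) ^ 2 := by
  rw [noiseCost_eq]
  set u : ℝ := n / ((k : ℝ) + 1) ^ (2 * α + 1) with hu
  have hu0 : 0 ≤ u := by positivity
  have h1 := Real.log_le_sub_one_of_pos (x := 1 + u) (by positivity)
  have h2 : 1 - u ≤ 1 / (1 + u) := by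
    rw [le_div_iff₀ (by positivity)]
    nlinarith
  have h3 : 1 / (1 + u) ≤ 1 - u + u ^ 2 := by
    rw [div_le_iff₀ (by positivity)]
    nlinarith [pow_nonneg hu0 3]
  linarith

lemma noiseCost_le_sqrt {n : ℕ} (hn : 1 ≤ n) (k : ℕ) :
    noiseCost n 1 k ≤ 2 * (n : ℝ) ^ (1 / 2 : ℝ) * ((k : ℝ) + 1) ^ (-1 - 1 / 2 : ℝ) := by
  have hn0 : (0 : ℝ) < n := by exact_mod_cast hn
  have h1 := log_one_add_le_two_sqrt (u := n / ((k : ℝ) + 1) ^ (2 * 1 + 1 : ℝ)) (by positivity)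
  have h2 := shrink_nonneg n 1 k
  rw [div_rpow_rpow hn0 (by positivity)] at h1
  unfold noiseCost
  norm_num at h1 ⊢
  linarith

/-- With `u = n / k ^ (2 α + 1)` (one-based `k`) the cost `log (1 + u) - u / (1 + u)` increases in
`u`; the bound is its value at `u = 1`. -/
lemma le_noiseCost {n : ℕ} {α : ℝ} {k : ℕ} (h : ((k : ℝ) + 1) ^ (2 * α + 1) ≤ n) :
    Real.log 2 - 1 / 2 ≤ noiseCost n α k := by
  rw [noiseCost_eq]
  set u : ℝ := n / ((k : ℝ) + 1) ^ (2 * α + 1) with hu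
  have hu1 : 1 ≤ u := by rw [hu, one_le_div (by positivity)]; exact h
  have h1 := Real.one_sub_inv_le_log_of_pos (x := (1 + u) / 2) (by positivity)
  rw [Real.log_div (by positivity) (by norm_num), inv_div] at h1
  have h2 : 1 / (1 + u) ≤ 1 / 2 := by
    apply one_div_le_one_div_of_le <;> linarith
  have h3 : 2 / (1 + u) = 2 * (1 / (1 + u)) := by ring
  linarith

lemma summable_noiseCost (n : ℕ) {α : ℝ} (hα : 0 ≤ α) : Summable (noiseCost n α) := by
  have h : Summable fun k : ℕ => (n : ℝ) ^ 2 * ((k + 1 : ℕ) : ℝ) ^ (-2 : ℝ) :=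
    ((summable_nat_add_iff 1).2 (Real.summable_nat_rpow.2 (by norm_num))).mul_left _
  refine h.of_nonneg_of_le (noiseCost_nonneg n α) fun k => (noiseCost_le_sq n α k).trans ?_
  have hk := one_le_natCast_add_one k
  rw [div_pow, div_eq_mul_inv]
  push_cast
  rw [Real.rpow_neg (by positivity)]
  gcongr
  rw [← Real.rpow_natCast _ 2, ← Real.rpow_mul (by positivity)]
  apply Real.rpow_le_rpow_of_exponent_le hk
  push_cast
  linarith

/-- Partial sums of the centred squares of the noise. -/
def noiseSum (z : ℕ → ℝ) (m : ℕ) : ℝ := ∑ j ∈ Finset.range m, (z j ^ 2 - 1)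

/-- Summation by parts. It copes with the conditional convergence at `α = 0` and moves the
dependence on `α` into increments that can be bounded uniformly, so no supremum over a random
process is needed. -/
lemma sum_mul_noise_eq (s z : ℕ → ℝ) (N : ℕ) :
    ∑ k ∈ Finset.range N, s k * (z k ^ 2 - 1) =
      s N * noiseSum z N + ∑ k ∈ Finset.range N, (s k - s (k + 1)) * noiseSum z (k + 1) := by
  induction N with
  | zero => simp [noiseSum]
  | succ N ih =>
    have h : noiseSum z (N + 1) = noiseSum z N + (z N ^ 2 - 1) := Finset.sum_range_succ _ _
    rw [Finset.sum_range_succ, ih, Finset.sum_range_succ, h]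
    ring

/-- A bound, uniform over `α ∈ [0, 1/2]`, for the increments of the shrinkage factors. -/
def shrinkIncrement (n k : ℕ) : ℝ := 2 * n / (((k : ℝ) + 2) * ((k : ℝ) + 1 + n))

lemma shrinkIncrement_nonneg (n k : ℕ) : 0 ≤ shrinkIncrement n k := by
  unfold shrinkIncrement; positivity

/-- Bernoulli's inequality with exponent `p = 2 α + 1 ≤ 2` bounds the relative increment of `x ^ p`
by `2 / (x + 1)`, and `x ≤ x ^ p` removes `α` from the denominator. -/
lemma abs_shrink_sub_succ_le {n : ℕ} {α : ℝ} (h0 : 0 ≤ α) (h1 : α ≤ 1 / 2)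
    (k : ℕ) : |shrink n α k - shrink n α (k + 1)| ≤ shrinkIncrement n k := by
  have hn0 : (0 : ℝ) ≤ n := n.cast_nonneg
  set x : ℝ := (k : ℝ) + 1 with hx
  have hx1 : 1 ≤ x := one_le_natCast_add_one k
  set p : ℝ := 2 * α + 1 with hp
  have hA : 0 < x ^ p := by positivity
  have hB : 0 < (x + 1) ^ p := by positivity
  have hmono : x ^ p ≤ (x + 1) ^ p := by gcongr; linarith
  have hxp : x ≤ x ^ p := by
    calc x = x ^ (1 : ℝ) := (Real.rpow_one x).symm
      _ ≤ x ^ p := Real.rpow_le_rpow_of_exponent_le hx1 (by linarith)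
  have hbern : (x + 1) ^ p * (1 - p / (x + 1)) ≤ x ^ p := by
    have hb := one_add_mul_self_le_rpow_one_add (s := -(1 / (x + 1))) (p := p)
      (by
        have : 1 / (x + 1) ≤ 1 := by rw [div_le_one (by positivity)]; linarith
        linarith) (by linarith)
    have e : x = (x + 1) * (1 + -(1 / (x + 1))) := by field_simp; ring
    have h2 : (0 : ℝ) ≤ 1 + -(1 / (x + 1)) := by
      have : 1 / (x + 1) ≤ 1 := by rw [div_le_one (by positivity)]; linarith
      linarith
    calc (x + 1) ^ p * (1 - p / (x + 1)) = (x + 1) ^ p * (1 + p * -(1 / (x + 1))) := by ring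
      _ ≤ (x + 1) ^ p * (1 + -(1 / (x + 1))) ^ p := by gcongr
      _ = x ^ p := by rw [← Real.mul_rpow (by positivity) h2, ← e]
  have hdiff : (x + 1) ^ p - x ^ p ≤ 2 / (x + 1) * (x + 1) ^ p := by
    have h3 : (x + 1) ^ p - x ^ p ≤ p / (x + 1) * (x + 1) ^ p := by linarith
    refine h3.trans ?_
    gcongr
    linarith
  have e : shrink n α k - shrink n α (k + 1) =
      n * ((x + 1) ^ p - x ^ p) / ((x ^ p + n) * ((x + 1) ^ p + n)) := by
    unfold shrink
    push_cast
    rw [← hx, ← hp]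
    field_simp
    ring
  rw [e, abs_of_nonneg (div_nonneg (mul_nonneg hn0 (by linarith)) (by positivity))]
  calc n * ((x + 1) ^ p - x ^ p) / ((x ^ p + n) * ((x + 1) ^ p + n))
      ≤ n * (2 / (x + 1) * (x + 1) ^ p) / ((x ^ p + n) * ((x + 1) ^ p + n)) := by gcongr
    _ = 2 * n / ((x + 1) * (x ^ p + n)) * ((x + 1) ^ p / ((x + 1) ^ p + n)) := by
        field_simp
    _ ≤ 2 * n / ((x + 1) * (x ^ p + n)) * 1 := by
        gcongr
        rw [div_le_one (by positivity)]
        linarith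
    _ ≤ shrinkIncrement n k := by
        unfold shrinkIncrement
        rw [mul_one, ← hx, show (k : ℝ) + 2 = x + 1 by rw [hx]; ring]
        gcongr

/-- The part of `-2 ℓ_n` stemming from the signal. -/
def signalTerm (n : ℕ) (f z : ℕ → ℝ) (k : ℕ) : ℝ := 2 * √n * f k * z k + n * f k ^ 2

/-- Since `n y ^ 2` is `z ^ 2` plus the signal term, centring `z ^ 2` moves one shrinkage factor
into `noiseCost`. -/
lemma likelihoodTerm_eq {n : ℕ} (hn : 1 ≤ n) {y f z : ℕ → ℝ} (α : ℝ) (k : ℕ)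
    (hy : y k = f k + z k / √n) :
    likelihoodTerm n y α k = noiseCost n α k - shrink n α k * (z k ^ 2 - 1)
      - shrink n α k * signalTerm n f z k := by
  have hn0 : (0 : ℝ) < n := by exact_mod_cast hn
  have h1 : (n : ℝ) * y k ^ 2 = n * f k ^ 2 + 2 * √n * f k * z k + z k ^ 2 := by
    rw [hy]
    have h2 : √(n : ℝ) ^ 2 = n := Real.sq_sqrt hn0.le
    have h3 : √(n : ℝ) ≠ 0 := by positivity
    have e : (n : ℝ) * (f k + z k / √n) ^ 2 =
      n * f k ^ 2 + (n / √n) * (2 * f k * z k) + (n / √n ^ 2) * z k ^ 2 := by ring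
    rw [e, h2, div_self hn0.ne', Real.div_sqrt]
    ring
  unfold likelihoodTerm noiseCost signalTerm
  have h4 : (n : ℝ) ^ 2 / (((k : ℝ) + 1) ^ (2 * α + 1) + n) * y k ^ 2 =
      shrink n α k * (n * y k ^ 2) := by
    unfold shrink
    ring
  rw [h4, h1]
  ring

/-! ### Convergence and comparison of likelihoods -/

/-- Conditions on the noise, satisfied almost surely, under which the likelihood series
converges. -/
structure IsRegularNoise (n : ℕ) (f z : ℕ → ℝ) : Prop where
  tendsto_noiseSum : Tendsto (fun N : ℕ => noiseSum z N / N) atTop (𝓝 0)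
  summable_noiseSum : Summable fun k => shrinkIncrement n k * |noiseSum z (k + 1)|
  summable_signal : Summable fun k => shrink n 0 k * (2 * √n * |f k| * |z k|)
  summable_sq : Summable fun k => f k ^ 2
  summable_rpow : ∀ c : ℝ, 0 < c → Summable fun k : ℕ => ((k : ℝ) + 1) ^ (-1 - c) * z k ^ 2

/-- The boundary term of the summation by parts vanishes: the shrinkage factor is at most `n / N`,
while the noise sum is `o(N)`. -/
lemma IsRegularNoise.tendsto_shrink_mul {n : ℕ} {f z : ℕ → ℝ} (h : IsRegularNoise n f z)
    {α : ℝ} (hα : 0 ≤ α) :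
    Tendsto (fun N => shrink n α N * |noiseSum z N|) atTop (𝓝 0) := by
  have h1 : Tendsto (fun N : ℕ => (n : ℝ) * |noiseSum z N / N|) atTop (𝓝 0) := by
    simpa using h.tendsto_noiseSum.abs.const_mul (n : ℝ)
  refine squeeze_zero' (Eventually.of_forall fun N =>
    mul_nonneg (shrink_nonneg _ _ _) (abs_nonneg _)) ?_ h1
  filter_upwards [eventually_ge_atTop 1] with N hN
  have hN0 : (0 : ℝ) < N := by exact_mod_cast hN
  have h2 : shrink n α N ≤ n / N := by
    refine (shrink_antitone n hα N).trans ?_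
    unfold shrink
    norm_num
    gcongr
    linarith [n.cast_nonneg (α := ℝ)]
  rw [abs_div, abs_of_pos hN0]
  calc shrink n α N * |noiseSum z N| ≤ n / N * |noiseSum z N| := by gcongr
    _ = _ := by ring

lemma IsRegularNoise.summable_shrink_mul_signal {n : ℕ} {f z : ℕ → ℝ}
    (h : IsRegularNoise n f z) {α : ℝ} (hα : 0 ≤ α) :
    Summable fun k => shrink n α k * signalTerm n f z k := by
  refine Summable.of_norm_bounded (h.summable_signal.add (h.summable_sq.mul_left (n : ℝ)))
    fun k => ?_
  rw [Real.norm_eq_abs, abs_mul, abs_of_nonneg (shrink_nonneg _ _ _)]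
  have h1 : |signalTerm n f z k| ≤ 2 * √n * |f k| * |z k| + n * f k ^ 2 := by
    unfold signalTerm
    refine (abs_add_le _ _).trans (le_of_eq ?_)
    rw [abs_mul, abs_mul, abs_of_nonneg (by positivity : 0 ≤ 2 * √(n : ℝ)),
      abs_of_nonneg (by positivity : 0 ≤ (n : ℝ) * f k ^ 2)]
  have h2 := shrink_antitone n hα k
  have h3 := shrink_le_one n α k
  have h4 := shrink_nonneg n α k
  calc shrink n α k * |signalTerm n f z k|
      ≤ shrink n α k * (2 * √n * |f k| * |z k|) + shrink n α k * (n * f k ^ 2) := by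
        rw [← mul_add]; gcongr
    _ ≤ shrink n 0 k * (2 * √n * |f k| * |z k|) + 1 * (n * f k ^ 2) := by gcongr
    _ = _ := by rw [one_mul]

lemma IsRegularNoise.exists_tendsto_likelihood {n : ℕ} (hn : 1 ≤ n) {y f z : ℕ → ℝ}
    (h : IsRegularNoise n f z) (hy : ∀ k, y k = f k + z k / √n) {α : ℝ} (h0 : 0 ≤ α)
    (h1 : α ≤ 1 / 2) :
    ∃ l, Tendsto (fun N => ∑ k ∈ Finset.range N, likelihoodTerm n y α k) atTop (𝓝 l) := by
  have hA : Tendsto (fun N => shrink n α N * noiseSum z N) atTop (𝓝 0) := by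
    refine squeeze_zero_norm (fun N => le_of_eq ?_) (h.tendsto_shrink_mul h0)
    rw [Real.norm_eq_abs, abs_mul, abs_of_nonneg (shrink_nonneg _ _ _)]
  have hB : Summable fun k => (shrink n α k - shrink n α (k + 1)) * noiseSum z (k + 1) := by
    refine Summable.of_norm_bounded h.summable_noiseSum fun k => ?_
    rw [Real.norm_eq_abs, abs_mul]
    exact mul_le_mul_of_nonneg_right (abs_shrink_sub_succ_le h0 h1 k) (abs_nonneg _)
  have hT := (((summable_noiseCost n h0).hasSum.tendsto_sum_nat.sub
    (hA.add hB.hasSum.tendsto_sum_nat)).sub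
      (h.summable_shrink_mul_signal h0).hasSum.tendsto_sum_nat)
  refine ⟨_, hT.congr fun N => ?_⟩
  rw [← sum_mul_noise_eq, ← Finset.sum_sub_distrib, ← Finset.sum_sub_distrib]
  exact Finset.sum_congr rfl fun k _ => (likelihoodTerm_eq hn α k (hy k)).symm

lemma logLikelihood_eq_of_tendsto {n : ℕ} {y : ℕ → ℝ} {α l : ℝ}
    (h : Tendsto (fun N => ∑ k ∈ Finset.range N, likelihoodTerm n y α k) atTop (𝓝 l)) :
    logLikelihood n y α = -(1 / 2) * l := by
  unfold logLikelihood
  congr 1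
  exact h.limUnder_eq

/-- A summable majorant of the likelihood terms over `α ≥ c`. -/
lemma IsRegularNoise.exists_summable_bound {n : ℕ} {y f z : ℕ → ℝ}
    (h : IsRegularNoise n f z) (hy : ∀ k, y k = f k + z k / √n) {c : ℝ} (hc : 0 < c) :
    ∃ u : ℕ → ℝ, Summable u ∧ ∀ k, ∀ α ∈ Ici c, ‖likelihoodTerm n y α k‖ ≤ u k := by
  have hs0 : Summable fun k : ℕ => ((k : ℝ) + 1) ^ (-1 - 2 * c) := by
    have := (summable_nat_add_iff 1).2 (Real.summable_nat_rpow.2 (by linarith : -1 - 2 * c < -1))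
    simpa using this
  have hs1 := h.summable_rpow (2 * c) (by linarith)
  refine ⟨fun k => n * ((k : ℝ) + 1) ^ (-1 - 2 * c) + (n : ℝ) ^ 2 *
    (2 * f k ^ 2 + 2 / n * (((k : ℝ) + 1) ^ (-1 - 2 * c) * z k ^ 2)), ?_, fun k α hα => ?_⟩
  · exact (hs0.mul_left _).add (((h.summable_sq.mul_left _).add (hs1.mul_left _)).mul_left _)
  have hk := one_le_natCast_add_one k
  have hα' : c ≤ α := hα
  have hx : (((k : ℝ) + 1) ^ (2 * α + 1))⁻¹ ≤ ((k : ℝ) + 1) ^ (-1 - 2 * c) := by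
    rw [← Real.rpow_neg (by positivity)]
    exact Real.rpow_le_rpow_of_exponent_le hk (by linarith)
  have hx1 : ((k : ℝ) + 1) ^ (-1 - 2 * c) ≤ 1 :=
    Real.rpow_le_one_of_one_le_of_nonpos hk (by linarith)
  have hp : 0 < ((k : ℝ) + 1) ^ (2 * α + 1) := by positivity
  unfold likelihoodTerm
  refine (norm_sub_le _ _).trans (add_le_add ?_ ?_)
  · have h1 : (0 : ℝ) ≤ n / ((k : ℝ) + 1) ^ (2 * α + 1) := by positivity
    rw [Real.norm_of_nonneg (Real.log_nonneg (by linarith))]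
    have h2 := Real.log_le_sub_one_of_pos (x := 1 + n / ((k : ℝ) + 1) ^ (2 * α + 1))
      (by positivity)
    refine h2.trans ?_
    rw [div_eq_mul_inv, add_sub_cancel_left]
    gcongr
  · rw [Real.norm_of_nonneg (by positivity), div_eq_mul_inv, mul_assoc]
    have hy2 : y k ^ 2 ≤ 2 * f k ^ 2 + 2 / n * z k ^ 2 := by
      rw [hy k]
      have e : (z k / √n) ^ 2 = 1 / n * z k ^ 2 := by
        rw [div_pow, Real.sq_sqrt n.cast_nonneg]; ring
      have : (f k + z k / √n) ^ 2 ≤ 2 * f k ^ 2 + 2 * (z k / √n) ^ 2 := by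
        nlinarith [sq_nonneg (f k - z k / √n)]
      refine this.trans (le_of_eq ?_)
      rw [e]; ring
    have hx2 : (((k : ℝ) + 1) ^ (2 * α + 1) + n)⁻¹ ≤ ((k : ℝ) + 1) ^ (-1 - 2 * c) := by
      refine le_trans ?_ hx
      gcongr
      linarith [n.cast_nonneg (α := ℝ)]
    gcongr
    calc (((k : ℝ) + 1) ^ (2 * α + 1) + n)⁻¹ * y k ^ 2
        ≤ ((k : ℝ) + 1) ^ (-1 - 2 * c) * (2 * f k ^ 2 + 2 / n * z k ^ 2) := by gcongr
      _ = ((k : ℝ) + 1) ^ (-1 - 2 * c) * (2 * f k ^ 2) +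
          2 / n * (((k : ℝ) + 1) ^ (-1 - 2 * c) * z k ^ 2) := by ring
      _ ≤ 1 * (2 * f k ^ 2) + 2 / n * (((k : ℝ) + 1) ^ (-1 - 2 * c) * z k ^ 2) := by gcongr
      _ = _ := by ring

/-- The Weierstrass test works away from zero only; near zero a strict comparison with `α = 1`
replaces continuity. -/
lemma IsRegularNoise.continuousOn_logLikelihood {n : ℕ} {y f z : ℕ → ℝ}
    (h : IsRegularNoise n f z) (hy : ∀ k, y k = f k + z k / √n) {c : ℝ} (hc : 0 < c) :
    ContinuousOn (logLikelihood n y) (Ici c) := by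
  obtain ⟨u, hu, hbound⟩ := h.exists_summable_bound hy hc
  have hcont : ContinuousOn (fun α => ∑' k, likelihoodTerm n y α k) (Ici c) := by
    refine continuousOn_tsum (fun k => ?_) hu hbound
    have hk : (0 : ℝ) < (k : ℝ) + 1 := by positivity
    have h1 : Continuous fun α : ℝ => ((k : ℝ) + 1) ^ (2 * α + 1) :=
      Continuous.rpow (by fun_prop) (by fun_prop) fun α => Or.inl hk.ne'
    refine Continuous.continuousOn ?_
    unfold likelihoodTerm
    refine Continuous.sub (Continuous.log ?_ fun α => ?_) (Continuous.mul ?_ continuous_const)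
    · exact continuous_const.add (continuous_const.div h1 fun α => by positivity)
    · positivity
    · exact continuous_const.div (h1.add continuous_const) fun α => by positivity
  refine (hcont.const_smul (-(1 / 2) : ℝ)).congr fun α hα => ?_
  exact logLikelihood_eq_of_tendsto
    (Summable.of_norm_bounded hu fun k => hbound k α hα).hasSum.tendsto_sum_nat

lemma log_two_sub_half_pos : 0 < Real.log 2 - 1 / 2 := by
  have := Real.log_two_gt_d9
  linarith

/-- The marginal likelihood near `α = 0` is smaller than at `α = 1`. -/
lemma IsRegularNoise.logLikelihood_lt {n : ℕ} (hn : 1 ≤ n) {y f z : ℕ → ℝ}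
    (h : IsRegularNoise n f z) (hy : ∀ k, y k = f k + z k / √n) {α c e d g : ℝ} (h0 : 0 ≤ α)
    (hαc : α ≤ c) (hc : c ≤ 1 / 2) {m : ℕ}
    (he : ∀ N, ∑ k ∈ Finset.range N, (shrinkIncrement n k * |noiseSum z (k + 1)| +
      shrink n 1 k * |z k ^ 2 - 1| + shrink n 0 k * (2 * √n * |f k| * |z k|)) ≤ e)
    (hd : ∀ N, ∑ k ∈ Finset.range N, (1 - shrink n 1 k) * (n * f k ^ 2) ≤ d)
    (hg : ∀ N, ∑ k ∈ Finset.range N, noiseCost n 1 k ≤ g)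
    (hm : ∀ k < m, ((k : ℝ) + 1) ^ (2 * c + 1) ≤ n)
    (hlt : e + d + g < m * (Real.log 2 - 1 / 2)) :
    logLikelihood n y α < logLikelihood n y 1 := by
  obtain ⟨l, hl⟩ := h.exists_tendsto_likelihood hn hy h0 (hαc.trans hc)
  obtain ⟨u, hu, hbound⟩ := h.exists_summable_bound hy one_pos
  have hl1 := (Summable.of_norm_bounded hu fun k =>
    hbound k 1 (mem_Ici.2 le_rfl)).hasSum.tendsto_sum_nat
  set l1 := ∑' k, likelihoodTerm n y 1 k
  rw [logLikelihood_eq_of_tendsto hl, logLikelihood_eq_of_tendsto hl1]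
  -- The comparison is made for partial sums; the added boundary term tends to zero, hence the `+ 0`
  -- in the limit.
  have hlim := (hl.sub hl1).add (h.tendsto_shrink_mul h0)
  have hge : m * (Real.log 2 - 1 / 2) - g - e - d ≤ l - l1 + 0 := by
    refine ge_of_tendsto hlim ?_
    filter_upwards [eventually_ge_atTop m] with N hN
    have hcost : m * (Real.log 2 - 1 / 2) ≤ ∑ k ∈ Finset.range N, noiseCost n α k := by
      calc m * (Real.log 2 - 1 / 2) = ∑ k ∈ Finset.range m, (Real.log 2 - 1 / 2) := by
              rw [Finset.sum_const, Finset.card_range, nsmul_eq_mul]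
        _ ≤ ∑ k ∈ Finset.range m, noiseCost n α k := by
          refine Finset.sum_le_sum fun k hk => le_noiseCost ?_
          refine le_trans ?_ (hm k (Finset.mem_range.1 hk))
          exact Real.rpow_le_rpow_of_exponent_le (one_le_natCast_add_one k) (by linarith)
        _ ≤ _ := Finset.sum_le_sum_of_subset_of_nonneg (Finset.range_mono hN)
          fun k _ _ => noiseCost_nonneg n α k
    have hnoise : ∑ k ∈ Finset.range N, shrink n α k * (z k ^ 2 - 1) ≤
        shrink n α N * |noiseSum z N| +
          ∑ k ∈ Finset.range N, shrinkIncrement n k * |noiseSum z (k + 1)| := by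
      rw [sum_mul_noise_eq]
      refine add_le_add (mul_le_mul_of_nonneg_left (le_abs_self _) (shrink_nonneg _ _ _))
        (Finset.sum_le_sum fun k _ => ?_)
      refine (le_abs_self _).trans ?_
      rw [abs_mul]
      exact mul_le_mul_of_nonneg_right (abs_shrink_sub_succ_le h0 (hαc.trans hc) k) (abs_nonneg _)
    -- The squared signal must be kept as a difference between `α` and 1, because either part alone
    -- may be of order `n`. The noise at `α = 1` and the cross term are small enough to be bounded
    -- by absolute values.
    have hterm : ∀ k, noiseCost n α k - noiseCost n 1 k - shrink n α k * (z k ^ 2 - 1) -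
        shrink n 1 k * |z k ^ 2 - 1| - shrink n 0 k * (2 * √n * |f k| * |z k|) -
        (1 - shrink n 1 k) * (n * f k ^ 2) ≤
        likelihoodTerm n y α k - likelihoodTerm n y 1 k := by
      intro k
      rw [likelihoodTerm_eq hn α k (hy k), likelihoodTerm_eq hn 1 k (hy k)]
      have a0 := shrink_nonneg n 1 k
      have a1 := shrink_antitone n h0 k
      have a2 := shrink_antitone n (hαc.trans (hc.trans (by norm_num : (1 / 2 : ℝ) ≤ 1))) k
      have a3 := shrink_le_one n α k
      have s1 : -(shrink n 1 k * |z k ^ 2 - 1|) ≤ shrink n 1 k * (z k ^ 2 - 1) := by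
        have := mul_le_mul_of_nonneg_left (neg_abs_le (z k ^ 2 - 1)) a0
        linarith
      have s2 : (shrink n α k - shrink n 1 k) * signalTerm n f z k ≤
          shrink n 0 k * (2 * √n * |f k| * |z k|) + (1 - shrink n 1 k) * (n * f k ^ 2) := by
        unfold signalTerm
        rw [mul_add]
        have b1 : 2 * √n * f k * z k ≤ 2 * √n * |f k| * |z k| := by
          rw [mul_assoc, mul_assoc _ |f k|, ← abs_mul]
          exact mul_le_mul_of_nonneg_left (le_abs_self _) (by positivity)
        refine add_le_add ?_ (mul_le_mul_of_nonneg_right (by linarith) (by positivity))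
        calc (shrink n α k - shrink n 1 k) * (2 * √n * f k * z k)
            ≤ (shrink n α k - shrink n 1 k) * (2 * √n * |f k| * |z k|) :=
              mul_le_mul_of_nonneg_left b1 (by linarith)
          _ ≤ _ := mul_le_mul_of_nonneg_right (by linarith) (by positivity)
      linarith
    have hsum := Finset.sum_le_sum (s := Finset.range N) fun k _ => hterm k
    simp only [Finset.sum_sub_distrib] at hsum
    have he' := he N
    simp only [Finset.sum_add_distrib] at he'
    have := hd N
    have := hg N
    linarith
  linarith

/-! ### Size of the stochastic errors -/

/-- The total stochastic error in the comparison of likelihoods. -/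
def noiseError (n : ℕ) (f z : ℕ → ℝ) : ℝ≥0∞ :=
  ∑' k, ENNReal.ofReal (shrinkIncrement n k * |noiseSum z (k + 1)| +
      shrink n 1 k * |z k ^ 2 - 1| + shrink n 0 k * (2 * √n * |f k| * |z k|))

lemma measurable_noiseSum (m : ℕ) : Measurable fun z => noiseSum z m := by
  unfold noiseSum
  fun_prop

lemma measurable_noiseError (n : ℕ) (f : ℕ → ℝ) : Measurable (noiseError n f) := by
  unfold noiseError
  refine Measurable.tsum fun k => ?_
  have := measurable_noiseSum (k + 1)
  fun_prop

lemma integral_abs_gaussian_le : ∫ x, |x| ∂(gaussianReal 0 1) ≤ 1 := by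
  have h1 : Integrable (fun x : ℝ => (1 + x ^ 2) / 2) (gaussianReal 0 1) :=
    ((integrable_const _).add integrable_sq_gaussian).div_const _
  calc ∫ x, |x| ∂(gaussianReal 0 1) ≤ ∫ x, (1 + x ^ 2) / 2 ∂(gaussianReal 0 1) := by
        refine integral_mono_of_nonneg (ae_of_all _ fun x => abs_nonneg x) h1
          (ae_of_all _ fun x => ?_)
        simp only
        nlinarith [sq_nonneg (|x| - 1), sq_abs x]
    _ = 1 := by
        rw [integral_div, integral_add (integrable_const _) integrable_sq_gaussian,
          integral_sq_gaussian]
        simp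

lemma lintegral_abs_le (c : ℝ) (hc : 0 ≤ c) (k : ℕ) :
    ∫⁻ z, ENNReal.ofReal (c * |z k|) ∂stdNoise ≤ ENNReal.ofReal c := by
  have hi : Integrable (fun x : ℝ => |x|) (gaussianReal 0 1) :=
    ((memLp_id_gaussianReal (μ := 0) (v := 1) 1).integrable (by norm_num)).abs
  rw [(measurePreserving_eval_stdNoise k).lintegral_comp
    (f := fun x : ℝ => ENNReal.ofReal (c * |x|)) (by fun_prop),
    ← ofReal_integral_eq_lintegral_ofReal (hi.const_mul c)
      (ae_of_all _ fun x => by positivity), integral_const_mul]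
  refine ENNReal.ofReal_le_ofReal ?_
  nlinarith [integral_abs_gaussian_le]

lemma lintegral_abs_sq_sub_one_le (c : ℝ) (hc : 0 ≤ c) (k : ℕ) :
    ∫⁻ z, ENNReal.ofReal (c * |z k ^ 2 - 1|) ∂stdNoise ≤ ENNReal.ofReal (2 * c) := by
  calc ∫⁻ z, ENNReal.ofReal (c * |z k ^ 2 - 1|) ∂stdNoise
      ≤ ∫⁻ z, (ENNReal.ofReal (c * z k ^ 2) + ENNReal.ofReal c) ∂stdNoise := by
        refine lintegral_mono fun z => ?_
        rw [← ENNReal.ofReal_add (by positivity) hc]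
        refine ENNReal.ofReal_le_ofReal ?_
        have : |z k ^ 2 - 1| ≤ z k ^ 2 + 1 := by
          rw [abs_le]; constructor <;> nlinarith [sq_nonneg (z k)]
        nlinarith
    _ = ENNReal.ofReal (2 * c) := by
        rw [lintegral_add_right _ measurable_const, lintegral_ofReal_mul_sq c hc,
          lintegral_const, measure_univ, mul_one, ← ENNReal.ofReal_add hc hc, two_mul]

/-- The first absolute moment is at most the root of the second, which independence makes linear in
`m`. -/
lemma lintegral_abs_noiseSum_le (c : ℝ) (hc : 0 ≤ c) (m : ℕ) :
    ∫⁻ z, ENNReal.ofReal (c * |noiseSum z m|) ∂stdNoise ≤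
      ENNReal.ofReal (c * √(sqVar * m)) := by
  have hL : MemLp (fun z => noiseSum z m) 2 stdNoise := by
    have h1 := (memLp_sum_mul_sq (fun _ => 1) (Finset.range m)).sub
      (memLp_const (m : ℝ) (p := 2) (μ := stdNoise))
    refine h1.congr_norm (measurable_noiseSum m).aestronglyMeasurable (ae_of_all _ fun z => ?_)
    simp [noiseSum]
  have hvar : ∫ z, noiseSum z m ^ 2 ∂stdNoise = sqVar * m := by
    have h1 := variance_sum_mul_sq (fun _ => 1) (Finset.range m)
    rw [variance_eq_integral (Measurable.aemeasurable (by fun_prop)), integral_finsetSum _ fun k _ => integrable_mul_sq _ _]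
      at h1
    have h2 : ∀ k, ∫ z, 1 * z k ^ 2 ∂stdNoise = 1 := fun k => integral_mul_sq (fun _ => 1) k
    simp only [h2] at h1
    simpa [noiseSum] using h1
  have habs : ∫ z, |noiseSum z m| ∂stdNoise ≤ √(sqVar * m) := by
    have h1 := variance_nonneg (fun z => |noiseSum z m|) stdNoise
    rw [variance_eq_sub (X := fun z => |noiseSum z m|) hL.abs] at h1
    simp only [Pi.pow_apply, sq_abs, hvar] at h1
    exact Real.le_sqrt_of_sq_le (by linarith)
  have hi : Integrable (fun z => |noiseSum z m|) stdNoise := (hL.integrable (by norm_num)).abs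
  rw [← ofReal_integral_eq_lintegral_ofReal (hi.const_mul c)
      (ae_of_all _ fun x => by positivity), integral_const_mul]
  exact ENNReal.ofReal_le_ofReal (mul_le_mul_of_nonneg_left habs hc)

lemma tsum_ofReal_mul_rpow_le {A s : ℝ} (hA : 0 ≤ A) (hs : 0 < s) :
    ∑' k : ℕ, ENNReal.ofReal (A * ((k : ℝ) + 1) ^ (-1 - s)) ≤ ENNReal.ofReal (A * (1 + 1 / s)) := by
  rw [ENNReal.tsum_eq_iSup_sum]
  refine iSup_le fun S => ?_
  have h0 : ∀ k ∈ S, 0 ≤ A * ((k : ℝ) + 1) ^ (-1 - s) := fun k _ => by positivity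
  rw [← ENNReal.ofReal_sum_of_nonneg h0, ← Finset.mul_sum]
  exact ENNReal.ofReal_le_ofReal (mul_le_mul_of_nonneg_left (sum_rpow_le hs S) hA)

lemma abs_le_of_mem_hyperRectangle {β R : ℝ} {f : ℕ → ℝ} (hf : f ∈ hyperRectangle β R) (k : ℕ) :
    |f k| ≤ √R * ((k : ℝ) + 1) ^ (-(1 / 2) - β) := by
  have hk : (0 : ℝ) < (k : ℝ) + 1 := by positivity
  have h := hf.2 k
  have hR : 0 ≤ R := le_trans (by positivity) h
  refine abs_le_of_sq_le_sq ?_ (by positivity)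
  rw [mul_pow, Real.sq_sqrt hR, ← Real.rpow_natCast (_ ^ _) 2, ← Real.rpow_mul hk.le]
  have e : (-(1 / 2) - β) * ((2 : ℕ) : ℝ) = -(2 * β + 1) := by push_cast; ring
  rw [e, Real.rpow_neg hk.le, ← div_eq_mul_inv, le_div_iff₀ (by positivity)]
  linarith

/-- The expected stochastic error is of polynomially smaller order than `n`. -/
lemma lintegral_noiseError_le {β R t : ℝ} (hβt : t < β) (ht0 : 0 ≤ t)
    (ht : t ≤ 1 / 4) {n : ℕ} (hn : 1 ≤ n) {f : ℕ → ℝ} (hf : f ∈ hyperRectangle β R) :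
    ∫⁻ z, noiseError n f z ∂stdNoise ≤
      ENNReal.ofReal ((10 * √sqVar + 6 + 2 * √R * (1 + 1 / (β - t))) * (n : ℝ) ^ (1 - t)) := by
  have hn0 : (1 : ℝ) ≤ n := by exact_mod_cast hn
  have hnpos : (0 : ℝ) < n := by linarith
  have hβt' : 0 < β - t := by linarith
  set B : ℝ := (n : ℝ) ^ (1 - t) with hB
  have hB0 : 0 ≤ B := by positivity
  have hpow : ∀ θ : ℝ, θ ≤ 1 - t → (n : ℝ) ^ θ ≤ B := fun θ hθ =>
    Real.rpow_le_rpow_of_exponent_le hn0 hθ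
  have m1 : ∀ k : ℕ, Measurable fun z : ℕ → ℝ =>
      ENNReal.ofReal (shrinkIncrement n k * |noiseSum z (k + 1)|) := fun k => by
    have := measurable_noiseSum (k + 1)
    fun_prop
  -- With `θ = 3 / 4` the powers of `k` add up to `-1 - 3 / 4 + 1 / 2 = -1 - 1 / 4`, and `n ^ (3 /
  -- 4) ≤ n ^ (1 - t)` because `t ≤ 1 / 4`.
  have b1 : ∑' k, ∫⁻ z, ENNReal.ofReal (shrinkIncrement n k * |noiseSum z (k + 1)|) ∂stdNoise ≤
      ENNReal.ofReal (2 * √sqVar * B * (1 + 1 / (1 / 4))) := by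
    refine le_trans (ENNReal.tsum_le_tsum fun k => (lintegral_abs_noiseSum_le _
      (shrinkIncrement_nonneg n k) _).trans (ENNReal.ofReal_le_ofReal ?_))
      (tsum_ofReal_mul_rpow_le (by positivity) (by norm_num))
    have hk : (0 : ℝ) < (k : ℝ) + 1 := by positivity
    have h1 := (shrink_le_rpow hn 0 k (θ := 3 / 4) (by norm_num) (by norm_num)).trans
      (mul_le_mul_of_nonneg_right (hpow (3 / 4) (by linarith)) (by positivity))
    have h2 : shrinkIncrement n k ≤ 2 * ((k : ℝ) + 1) ^ (-1 : ℝ) * shrink n 0 k := by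
      unfold shrinkIncrement shrink
      rw [Real.rpow_neg_one, mul_zero, zero_add, Real.rpow_one]
      calc 2 * n / (((k : ℝ) + 2) * ((k : ℝ) + 1 + n))
          ≤ 2 * n / (((k : ℝ) + 1) * ((k : ℝ) + 1 + n)) := by gcongr; norm_num
        _ = _ := by field_simp
    rw [Real.sqrt_mul sqVar_nonneg]
    push_cast
    rw [Real.sqrt_eq_rpow ((k : ℝ) + 1)]
    calc shrinkIncrement n k * (√sqVar * ((k : ℝ) + 1) ^ (1 / 2 : ℝ))
        ≤ (2 * ((k : ℝ) + 1) ^ (-1 : ℝ) * (B * ((k : ℝ) + 1) ^ (-((2 * 0 + 1) * (3 / 4)) : ℝ))) *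
          (√sqVar * ((k : ℝ) + 1) ^ (1 / 2 : ℝ)) := by
          refine mul_le_mul_of_nonneg_right (h2.trans ?_) (by positivity)
          gcongr
      _ = 2 * √sqVar * B * (((k : ℝ) + 1) ^ (-1 : ℝ) *
          ((k : ℝ) + 1) ^ (-((2 * 0 + 1) * (3 / 4)) : ℝ) * ((k : ℝ) + 1) ^ (1 / 2 : ℝ)) := by ring
      _ = _ := by
          rw [← Real.rpow_add hk, ← Real.rpow_add hk]
          norm_num
  have b2 : ∑' k, ∫⁻ z, ENNReal.ofReal (shrink n 1 k * |z k ^ 2 - 1|) ∂stdNoise ≤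
      ENNReal.ofReal (2 * B * (1 + 1 / (1 / 2))) := by
    refine le_trans (ENNReal.tsum_le_tsum fun k => (lintegral_abs_sq_sub_one_le _
      (shrink_nonneg n 1 k) _).trans (ENNReal.ofReal_le_ofReal ?_))
      (tsum_ofReal_mul_rpow_le (by positivity) (by norm_num))
    have h1 := (shrink_le_rpow hn 1 k (θ := 1 / 2) (by norm_num) (by norm_num)).trans
      (mul_le_mul_of_nonneg_right (hpow (1 / 2) (by linarith)) (by positivity))
    norm_num at h1 ⊢
    linarith
  -- Here `θ = 1 / 2 - t`: together with `√n` it gives exactly `n ^ (1 - t)`, and the smoothness of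
  -- `f` leaves `k ^ (-1 - (β - t))`.
  have b3 : ∑' k, ∫⁻ z, ENNReal.ofReal (shrink n 0 k * (2 * √n * |f k| * |z k|)) ∂stdNoise ≤
      ENNReal.ofReal (2 * √R * B * (1 + 1 / (β - t))) := by
    refine le_trans (ENNReal.tsum_le_tsum fun k => ?_)
      (tsum_ofReal_mul_rpow_le (by positivity) hβt')
    have hk : (0 : ℝ) < (k : ℝ) + 1 := by positivity
    have hs := shrink_nonneg n 0 k
    have h := lintegral_abs_le (shrink n 0 k * (2 * √n * |f k|)) (by positivity) k
    simp only [mul_assoc] at h ⊢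
    refine h.trans (ENNReal.ofReal_le_ofReal ?_)
    have h1 := shrink_le_rpow hn 0 k (θ := 1 / 2 - t) (by linarith) (by linarith)
    have h2 := abs_le_of_mem_hyperRectangle hf k
    calc shrink n 0 k * (2 * (√n * |f k|)) ≤
        ((n : ℝ) ^ (1 / 2 - t) * ((k : ℝ) + 1) ^ (-((2 * 0 + 1) * (1 / 2 - t)))) *
          (2 * ((n : ℝ) ^ (1 / 2 : ℝ) * (√R * ((k : ℝ) + 1) ^ (-(1 / 2) - β)))) := by
          rw [← Real.sqrt_eq_rpow (n : ℝ)]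
          gcongr
      _ = 2 * √R * ((n : ℝ) ^ (1 / 2 - t) * (n : ℝ) ^ (1 / 2 : ℝ)) *
          (((k : ℝ) + 1) ^ (-((2 * 0 + 1) * (1 / 2 - t))) *
            ((k : ℝ) + 1) ^ (-(1 / 2) - β)) := by ring
      _ = 2 * (√R * (B * ((k : ℝ) + 1) ^ (-1 - (β - t)))) := by
          rw [← Real.rpow_add hk, ← Real.rpow_add hnpos]
          ring_nf
          rw [hB]
          ring_nf
  have hle : ∫⁻ z, noiseError n f z ∂stdNoise ≤
      ∑' k, ∫⁻ z, ENNReal.ofReal (shrinkIncrement n k * |noiseSum z (k + 1)|) ∂stdNoise +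
      ∑' k, ∫⁻ z, ENNReal.ofReal (shrink n 1 k * |z k ^ 2 - 1|) ∂stdNoise +
      ∑' k, ∫⁻ z, ENNReal.ofReal (shrink n 0 k * (2 * √n * |f k| * |z k|)) ∂stdNoise := by
    rw [← ENNReal.tsum_add, ← ENNReal.tsum_add]
    unfold noiseError
    rw [lintegral_tsum fun k => by
      have := measurable_noiseSum (k + 1)
      exact Measurable.aemeasurable (by fun_prop)]
    refine ENNReal.tsum_le_tsum fun k => ?_
    have m2 : Measurable fun z : ℕ → ℝ => ENNReal.ofReal (shrink n 1 k * |z k ^ 2 - 1|) := by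
      fun_prop
    have m12 : Measurable fun z : ℕ → ℝ =>
        ENNReal.ofReal (shrinkIncrement n k * |noiseSum z (k + 1)|) +
          ENNReal.ofReal (shrink n 1 k * |z k ^ 2 - 1|) := (m1 k).add m2
    rw [← lintegral_add_left (m1 k), ← lintegral_add_left m12]
    refine lintegral_mono fun z => ?_
    exact ENNReal.ofReal_add_le.trans (add_le_add_left ENNReal.ofReal_add_le _)
  refine (hle.trans (add_le_add (add_le_add b1 b2) b3)).trans (le_of_eq ?_)
  rw [← ENNReal.ofReal_add (by positivity) (by positivity),
    ← ENNReal.ofReal_add (by positivity) (by positivity)]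
  congr 1
  ring

lemma sum_range_le_of_noiseError_le {n : ℕ} {f z : ℕ → ℝ} {e : ℝ} (he : 0 ≤ e)
    (h : noiseError n f z ≤ ENNReal.ofReal e) (N : ℕ) :
    ∑ k ∈ Finset.range N, (shrinkIncrement n k * |noiseSum z (k + 1)| +
      shrink n 1 k * |z k ^ 2 - 1| + shrink n 0 k * (2 * √n * |f k| * |z k|)) ≤ e := by
  have h1 := (ENNReal.sum_le_tsum (Finset.range N)).trans h
  rw [← ENNReal.ofReal_sum_of_nonneg] at h1
  · exact (ENNReal.ofReal_le_ofReal_iff he).1 h1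
  · intro k _
    have := shrink_nonneg n 1 k
    have := shrink_nonneg n 0 k
    have := shrinkIncrement_nonneg n k
    positivity

lemma ae_tendsto_noiseSum :
    ∀ᵐ z ∂stdNoise, Tendsto (fun N : ℕ => noiseSum z N / N) atTop (𝓝 0) := by
  have hpres : ∀ k, MeasurePreserving (Function.eval k) stdNoise (gaussianReal 0 1) :=
    measurePreserving_eval_stdNoise
  have hint : Integrable (fun x : ℝ => x ^ 2 - 1) (gaussianReal 0 1) :=
    integrable_sq_gaussian.sub (integrable_const _)
  have h := strong_law_ae_real (μ := stdNoise) (fun k z => z k ^ 2 - 1)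
    ((hpres 0).integrable_comp_of_integrable hint)
    (fun i j hij => (iIndepFun_comp (f := fun _ x => x ^ 2 - 1) (fun k => by fun_prop)).indepFun hij)
    (fun i => ⟨Measurable.aemeasurable (by fun_prop), Measurable.aemeasurable (by fun_prop), by
      have e : ∀ k, stdNoise.map (fun z : ℕ → ℝ => z k ^ 2 - 1) =
          (gaussianReal 0 1).map fun x => x ^ 2 - 1 := fun k => by
        rw [← (hpres k).map_eq, Measure.map_map (by fun_prop) (by fun_prop)]
        rfl
      rw [e, e]⟩)
  have h0 : ∫ z, (z 0 ^ 2 - 1) ∂stdNoise = 0 := by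
    have h1 := integral_mul_sq (fun _ => 1) 0
    have h2 := integrable_mul_sq 1 0
    simp only [one_mul] at h1 h2
    rw [integral_sub h2 (integrable_const _), h1]
    simp
  rw [h0] at h
  exact h

/-- Countably many exponents `c = 1 / (m + 1)` suffice, since the terms decrease in `c`. -/
lemma ae_summable_rpow : ∀ᵐ z ∂stdNoise, ∀ c : ℝ, 0 < c →
    Summable fun k : ℕ => ((k : ℝ) + 1) ^ (-1 - c) * z k ^ 2 := by
  have hone : ∀ m : ℕ, ∀ᵐ z ∂stdNoise,
      Summable fun k : ℕ => ((k : ℝ) + 1) ^ (-1 - 1 / ((m : ℝ) + 1)) * z k ^ 2 := by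
    intro m
    have hs : Summable fun k : ℕ => ((k : ℝ) + 1) ^ (-1 - 1 / ((m : ℝ) + 1)) := by
      have hm : (0 : ℝ) < 1 / ((m : ℝ) + 1) := by positivity
      have := (summable_nat_add_iff 1).2
        (Real.summable_nat_rpow.2 (by linarith : -1 - 1 / ((m : ℝ) + 1) < -1))
      simpa using this
    filter_upwards [chiSum_ne_top_ae (fun k => by positivity) hs] with z hz
    have h1 := ENNReal.summable_toReal hz
    refine h1.congr fun k => ?_
    exact ENNReal.toReal_ofReal (by positivity)
  filter_upwards [ae_all_iff.2 hone] with z hz c hc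
  obtain ⟨m, hm⟩ := exists_nat_one_div_lt hc
  refine (hz m).of_nonneg_of_le (fun k => by positivity) fun k => ?_
  refine mul_le_mul_of_nonneg_right ?_ (sq_nonneg _)
  exact Real.rpow_le_rpow_of_exponent_le (one_le_natCast_add_one k) (by linarith)

lemma isRegularNoise_of_noiseError {n : ℕ} {f z : ℕ → ℝ} (hf : Summable fun k => f k ^ 2)
    (h : noiseError n f z ≠ ∞)
    (h1 : Tendsto (fun N : ℕ => noiseSum z N / N) atTop (𝓝 0))
    (h2 : ∀ c : ℝ, 0 < c → Summable fun k : ℕ => ((k : ℝ) + 1) ^ (-1 - c) * z k ^ 2) :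
    IsRegularNoise n f z := by
  have hp : ∀ k, 0 ≤ shrinkIncrement n k * |noiseSum z (k + 1)| := fun k =>
    mul_nonneg (shrinkIncrement_nonneg n k) (abs_nonneg _)
  have hq : ∀ k, 0 ≤ shrink n 1 k * |z k ^ 2 - 1| := fun k =>
    mul_nonneg (shrink_nonneg n 1 k) (abs_nonneg _)
  have hr : ∀ k, 0 ≤ shrink n 0 k * (2 * √n * |f k| * |z k|) := fun k =>
    mul_nonneg (shrink_nonneg n 0 k) (by positivity)
  have hs : Summable fun k => shrinkIncrement n k * |noiseSum z (k + 1)| +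
      shrink n 1 k * |z k ^ 2 - 1| + shrink n 0 k * (2 * √n * |f k| * |z k|) :=
    (ENNReal.summable_toReal h).congr fun k => ENNReal.toReal_ofReal (by
      linarith [hp k, hq k, hr k])
  exact ⟨h1, hs.of_nonneg_of_le hp fun k => by linarith [hq k, hr k],
    hs.of_nonneg_of_le hr fun k => by linarith [hp k, hq k], hf, h2⟩

/-- Interpolation with `θ = t` gains `n ^ (-t)` at the price of `k ^ (3 t)`, which the decay `k ^
(-2 β - 1)` absorbs. -/
lemma sum_signal_le {β R t : ℝ} (hβt : 3 * t < 2 * β) (ht0 : 0 ≤ t) (ht : t ≤ 1) {n : ℕ}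
    (hn : 1 ≤ n) {f : ℕ → ℝ} (hf : f ∈ hyperRectangle β R) (N : ℕ) :
    ∑ k ∈ Finset.range N, (1 - shrink n 1 k) * (n * f k ^ 2) ≤
      R * (1 + 1 / (2 * β - 3 * t)) * (n : ℝ) ^ (1 - t) := by
  have hnpos : (0 : ℝ) < n := by exact_mod_cast hn
  have hR : 0 ≤ R := le_trans (by positivity) (hf.2 0)
  have hβt' : 0 < 2 * β - 3 * t := by linarith
  have hterm : ∀ k : ℕ, (1 - shrink n 1 k) * (n * f k ^ 2) ≤
      R * (n : ℝ) ^ (1 - t) * ((k : ℝ) + 1) ^ (-1 - (2 * β - 3 * t)) := by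
    intro k
    have hk : (0 : ℝ) < (k : ℝ) + 1 := by positivity
    have h1 := one_sub_shrink_le_rpow hn 1 k ht0 ht
    have h2 : f k ^ 2 ≤ R * ((k : ℝ) + 1) ^ (-(2 * β + 1)) := by
      rw [Real.rpow_neg hk.le, ← div_eq_mul_inv, le_div_iff₀ (by positivity)]
      linarith [hf.2 k]
    calc (1 - shrink n 1 k) * (n * f k ^ 2)
        ≤ ((n : ℝ) ^ (-t) * ((k : ℝ) + 1) ^ ((2 * 1 + 1) * t)) *
          ((n : ℝ) ^ (1 : ℝ) * (R * ((k : ℝ) + 1) ^ (-(2 * β + 1)))) := by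
          rw [Real.rpow_one]
          gcongr
      _ = R * ((n : ℝ) ^ (-t) * (n : ℝ) ^ (1 : ℝ)) *
          (((k : ℝ) + 1) ^ ((2 * 1 + 1) * t) * ((k : ℝ) + 1) ^ (-(2 * β + 1))) := by ring
      _ = _ := by
          rw [← Real.rpow_add hk, ← Real.rpow_add hnpos]
          ring_nf
  refine (Finset.sum_le_sum fun k _ => hterm k).trans ?_
  rw [← Finset.mul_sum]
  have h3 := sum_rpow_le hβt' (Finset.range N)
  calc _ ≤ R * (n : ℝ) ^ (1 - t) * (1 + 1 / (2 * β - 3 * t)) := by gcongr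
    _ = _ := by ring

lemma sum_noiseCost_le {n : ℕ} (hn : 1 ≤ n) (N : ℕ) :
    ∑ k ∈ Finset.range N, noiseCost n 1 k ≤ 6 * (n : ℝ) ^ (1 / 2 : ℝ) := by
  refine (Finset.sum_le_sum fun k _ => noiseCost_le_sqrt hn k).trans ?_
  rw [← Finset.mul_sum]
  have h3 := sum_rpow_le (s := 1 / 2) (by norm_num) (Finset.range N)
  calc _ ≤ 2 * (n : ℝ) ^ (1 / 2 : ℝ) * (1 + 1 / (1 / 2)) := by gcongr
    _ = _ := by ring

/-- Compactness of `[c, a]` gives a maximizer there; since `1` lies in this interval and beats all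
of `[0, c]`, it is global. -/
lemma IsRegularNoise.maximizers_subset {n : ℕ} {y f z : ℕ → ℝ}
    (h : IsRegularNoise n f z) (hy : ∀ k, y k = f k + z k / √n) {c : ℝ} (hc : 0 < c)
    (hc1 : c ≤ 1) (hlt : ∀ α, 0 ≤ α → α ≤ c → logLikelihood n y α < logLikelihood n y 1)
    {a : ℝ} (ha : 1 ≤ a) :
    (maximizers n a y).Nonempty ∧ maximizers n a y ⊆ Ici c := by
  constructor
  · obtain ⟨x, hx, hmax⟩ := isCompact_Icc.exists_isMaxOn (s := Icc c a) ⟨1, hc1, ha⟩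
      ((h.continuousOn_logLikelihood hy hc).mono Icc_subset_Ici_self)
    refine ⟨x, ⟨hc.le.trans hx.1, hx.2⟩, fun α hα => ?_⟩
    rcases le_total c α with hcα | hcα
    · exact hmax ⟨hcα, hα.2⟩
    · exact (hlt α hα.1 hcα).le.trans (hmax ⟨hc1, ha⟩)
  · rintro α ⟨hα, hmax⟩
    by_contra hcα
    exact absurd (hmax ⟨zero_le_one, ha⟩) (not_le.2 (hlt α hα.1 (not_le.1 hcα).le))

/-! ### Maximizers away from zero -/

/-- Uniformly over the hyperrectangle, with probability tending to one the marginal likelihood has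
a maximizer and all its maximizers are bounded away from zero. -/
theorem exists_eventually_dataLaw_maximizers_le {β R : ℝ} (hβ : 0 < β) :
    ∃ c : ℝ, 0 < c ∧ ∀ η : ℝ, 0 < η → ∀ᶠ n : ℕ in atTop, ∀ f ∈ hyperRectangle β R,
      dataLaw n f {y | ¬ ∀ a, 1 ≤ a → (maximizers n a y).Nonempty ∧ maximizers n a y ⊆ Ici c} ≤
        ENNReal.ofReal η := by
  -- This `t` meets all the constraints `t ≤ 1 / 4`, `t < β` and `3 t < 2 β`. The exponent `κ` lies
  -- strictly between `1 - t` and 1, and `c` is defined by `(n ^ κ) ^ (2 c + 1) = n`.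
  set t : ℝ := min β 1 / 4 with ht
  have ht0 : 0 < t := by positivity
  have ht1 : t ≤ 1 / 4 := by rw [ht]; linarith [min_le_right β 1]
  have htβ : 4 * t ≤ β := by rw [ht]; linarith [min_le_left β 1]
  set κ : ℝ := 1 - t / 2 with hκ
  have hκ0 : 0 < κ := by linarith
  set c : ℝ := (1 / κ - 1) / 2 with hc
  have hc2 : 2 * c + 1 = 1 / κ := by rw [hc]; ring
  have hc0 : 0 < c := by
    have : 1 < 1 / κ := by rw [lt_div_iff₀ hκ0]; linarith
    linarith
  have hc1 : c ≤ 1 / 2 := by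
    have : 1 / κ ≤ 2 := by rw [div_le_iff₀ hκ0]; linarith
    linarith
  refine ⟨c, hc0, fun η hη => ?_⟩
  set K : ℝ := 10 * √sqVar + 6 + 2 * √R * (1 + 1 / (β - t)) with hK
  set D : ℝ := R * (1 + 1 / (2 * β - 3 * t)) with hD
  set c₀ : ℝ := Real.log 2 - 1 / 2 with hc₀
  have hc₀pos : 0 < c₀ := log_two_sub_half_pos
  have hA : Tendsto (fun n : ℕ => (n : ℝ) ^ κ) atTop atTop :=
    (tendsto_rpow_atTop hκ0).comp tendsto_natCast_atTop_atTop
  have hB : Tendsto (fun n : ℕ => (n : ℝ) ^ (-(t / 2))) atTop (𝓝 0) :=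
    (tendsto_rpow_neg_atTop (by linarith)).comp tendsto_natCast_atTop_atTop
  have hB1 : ∀ᶠ n : ℕ in atTop, (D + 6) * (n : ℝ) ^ (-(t / 2)) < c₀ / 8 := by
    have := hB.const_mul (D + 6)
    rw [mul_zero] at this
    exact this.eventually (gt_mem_nhds (by positivity))
  have hB2 : ∀ᶠ n : ℕ in atTop, K * (n : ℝ) ^ (-(t / 2)) < η * (c₀ / 2) := by
    have := hB.const_mul K
    rw [mul_zero] at this
    exact this.eventually (gt_mem_nhds (by positivity))
  filter_upwards [hB1, hB2, hA.eventually_ge_atTop 4, eventually_ge_atTop 1]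
    with n h1 h2 h3 hn f hf
  have hn0 : (1 : ℝ) ≤ n := by exact_mod_cast hn
  have hnpos : (0 : ℝ) < n := by linarith
  set A : ℝ := (n : ℝ) ^ κ with hAdef
  have hAB : (n : ℝ) ^ (1 - t) = A * (n : ℝ) ^ (-(t / 2)) := by
    rw [hAdef, ← Real.rpow_add hnpos, hκ]
    congr 1
    ring
  have hApos : 0 < A := by positivity
  -- Budget in units of `c₀ * A`: the stochastic error gets `1 / 2`, the deterministic errors `1 /
  -- 8`, and rounding `A` down to an integer costs at most `1 / 4` because `A ≥ 4`.
  set e : ℝ := c₀ / 2 * A with he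
  have hepos : 0 < e := by positivity
  have hmain : ∀ z y : ℕ → ℝ, (∀ k, y k = f k + z k / √n) → IsRegularNoise n f z →
      noiseError n f z < ENNReal.ofReal e →
      ∀ a, 1 ≤ a → (maximizers n a y).Nonempty ∧ maximizers n a y ⊆ Ici c := by
    intro z y hy hreg herr a ha
    refine hreg.maximizers_subset hy hc0 (by linarith) (fun α hα0 hαc => ?_) ha
    refine hreg.logLikelihood_lt hn hy hα0 hαc hc1 (m := ⌊A⌋₊)
      (sum_range_le_of_noiseError_le hepos.le herr.le)
      (sum_signal_le (by linarith) ht0.le (by linarith) hn hf) (sum_noiseCost_le hn)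
      (fun k hk => ?_) ?_
    · have hk1 : (k : ℝ) + 1 ≤ A := by
        have : ((k + 1 : ℕ) : ℝ) ≤ A := (Nat.le_floor_iff hApos.le).1 hk
        exact_mod_cast this
      calc ((k : ℝ) + 1) ^ (2 * c + 1) ≤ A ^ (2 * c + 1) := by gcongr
        _ = n := by
          rw [hc2, hAdef, ← Real.rpow_mul hnpos.le, mul_one_div_cancel hκ0.ne', Real.rpow_one]
    · have hfl : A - 1 < ⌊A⌋₊ := Nat.sub_one_lt_floor A
      have hhalf : (n : ℝ) ^ (1 / 2 : ℝ) ≤ (n : ℝ) ^ (1 - t) :=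
        Real.rpow_le_rpow_of_exponent_le hn0 (by linarith)
      have h4 : (D + 6) * (n : ℝ) ^ (1 - t) ≤ c₀ / 8 * A := by
        rw [hAB]
        have := mul_le_mul_of_nonneg_right h1.le hApos.le
        linarith
      have h5 : (A - 1) * c₀ < ⌊A⌋₊ * c₀ := mul_lt_mul_of_pos_right hfl hc₀pos
      have h6 : c₀ * 4 ≤ c₀ * A := mul_le_mul_of_nonneg_left h3 hc₀pos.le
      have h7 : 0 < c₀ * A := by positivity
      change c₀ / 2 * A + D * (n : ℝ) ^ (1 - t) + 6 * (n : ℝ) ^ (1 / 2 : ℝ) < ⌊A⌋₊ * c₀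
      linarith
  set T : (ℕ → ℝ) → ℕ → ℝ := fun y k => (y k - f k) / √((n : ℝ≥0)⁻¹ : ℝ≥0) with hT
  have hTm : Measurable T := by
    rw [hT]
    fun_prop
  have hmap : (dataLaw n f).map T = stdNoise :=
    map_infinitePi_gaussianReal f (fun _ => (n : ℝ≥0)⁻¹) fun _ => by
      simpa using (by omega : n ≠ 0)
  have hyT : ∀ y k, y k = f k + T y k / √n := by
    intro y k
    simp only [hT]
    push_cast
    rw [Real.sqrt_inv]
    have : √(n : ℝ) ≠ 0 := by positivity
    field_simp
    ring
  set Bad : Set (ℕ → ℝ) :=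
    {z | ¬ (IsRegularNoise n f z ∧ noiseError n f z < ENNReal.ofReal e)} with hBad
  have hreg : ∀ᵐ z ∂stdNoise, noiseError n f z < ENNReal.ofReal e →
      IsRegularNoise n f z := by
    filter_upwards [ae_tendsto_noiseSum, ae_summable_rpow] with z hz1 hz2 hz
    exact isRegularNoise_of_noiseError hf.1 hz.ne_top hz1 hz2
  calc dataLaw n f {y | ¬ ∀ a, 1 ≤ a → (maximizers n a y).Nonempty ∧ maximizers n a y ⊆ Ici c}
      ≤ dataLaw n f (T ⁻¹' Bad) := by
        refine measure_mono fun y hy => ?_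
        exact fun hgood => hy (hmain (T y) y (hyT y) hgood.1 hgood.2)
    -- This direction holds for every set, so measurability of the bad event is not needed.
    _ ≤ (dataLaw n f).map T Bad := Measure.le_map_apply hTm.aemeasurable _
    _ = stdNoise Bad := by rw [hmap]
    _ ≤ stdNoise {z | ENNReal.ofReal e ≤ noiseError n f z} := by
        refine measure_mono_ae ?_
        filter_upwards [hreg] with z hz hbad
        exact not_lt.1 fun hlt => hbad ⟨hz hlt, hlt⟩
    _ ≤ (∫⁻ z, noiseError n f z ∂stdNoise) / ENNReal.ofReal e :=
        meas_ge_le_lintegral_div (measurable_noiseError n f).aemeasurable (by simpa using hepos)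
          ENNReal.ofReal_ne_top
    _ ≤ ENNReal.ofReal (K * (n : ℝ) ^ (1 - t)) / ENNReal.ofReal e := by
        gcongr
        exact lintegral_noiseError_le (by linarith) ht0.le ht1 hn hf
    _ ≤ ENNReal.ofReal η := by
        rw [← ENNReal.ofReal_div_of_pos hepos]
        refine ENNReal.ofReal_le_ofReal ?_
        rw [div_le_iff₀ hepos, hAB, he]
        have := mul_le_mul_of_nonneg_right h2.le hApos.le
        linarith

/-! ### Assembly -/

/-- One parameter serves as threshold and as probability bound: apply the hypothesis to the minimum
of the two. -/
lemma UniformlyTendsToZeroInProbability.of_eventually {Q : Set (ℕ → ℝ)}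
    {X : ℕ → (ℕ → ℝ) → ℝ} (h : ∀ η : ℝ, 0 < η → ∀ᶠ n : ℕ in atTop, ∀ f ∈ Q,
      dataLaw n f {y | η ≤ |X n y|} ≤ ENNReal.ofReal η) :
    UniformlyTendsToZeroInProbability Q X := by
  intro η hη
  rw [ENNReal.tendsto_nhds_zero]
  intro ε hε
  obtain ⟨r, hr0, hr⟩ : ∃ r : ℝ, 0 < r ∧ ENNReal.ofReal r ≤ ε := by
    rcases eq_or_ne ε ∞ with rfl | hne
    · exact ⟨1, one_pos, le_top⟩
    · exact ⟨ε.toReal, ENNReal.toReal_pos hε.ne' hne, ENNReal.ofReal_toReal_le⟩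
  filter_upwards [h (min η r) (lt_min hη hr0)] with n hn
  refine iSup₂_le fun f hf => ?_
  refine (measure_mono fun y hy => ?_).trans ((hn f hf).trans
    ((ENNReal.ofReal_le_ofReal (min_le_right _ _)).trans hr))
  exact (min_le_left η r).trans (show η ≤ |X n y| from hy)

end SeqModel

end

theorem mainTheorem11
    (β R γ δ r₁ C : ℝ) (hβ : 0 < β) (hR : 0 < R) (hγ : γ ∈ Set.Ioo (0 : ℝ) 1)
    (hδ : 1 / 2 < δ) (hr₁ : 0 < r₁) (hC : 0 < C) (hCr : 1 / (2 * r₁) < C ^ 2)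
    (a : ℕ → ℝ) (ha : Tendsto a atTop atTop)
    (ha' : a =o[atTop] (fun n : ℕ => Real.log n))
    (α : ℕ → (ℕ → ℝ) → ℝ)
    (hα : SeqModel.IsSelection α (fun n y => SeqModel.maximizers n (a n) y))
    (ε : ℕ → (ℕ → ℝ) → ℝ)
    (hε : SeqModel.IsSelection ε (fun n y => Set.Icc (r₁ / Real.log n) (α n y / 2)))
    (ρ : ℕ → (ℕ → ℝ) → ℝ)
    (hρ : SeqModel.IsSelection ρ (fun n y => SeqModel.hRadii n (α n y) δ γ y))
    (q : ℕ → (ℕ → ℝ) → ℝ)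
    (hq : SeqModel.IsSelection q (fun n y => SeqModel.l2Radii n (α n y) γ y)) :
    SeqModel.UniformlyTendsToZeroInProbability (SeqModel.hyperRectangle β R)
      (fun n y =>
        (SeqModel.posterior n (α n y) y).real
            (SeqModel.hCredibleSet n (α n y) δ (ρ n y) (ε n y) C y ∩
              SeqModel.l2Ball n (α n y) (q n y) y)
          - (SeqModel.posterior n (α n y) y).real
              (SeqModel.hCredibleSet n (α n y) δ (ρ n y) (ε n y) C y)
            * (SeqModel.posterior n (α n y) y).real
              (SeqModel.l2Ball n (α n y) (q n y) y)) ∧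
    SeqModel.UniformlyTendsToZeroInProbability (SeqModel.hyperRectangle β R)
      (fun n y =>
        (SeqModel.posterior n (α n y) y).real
            (SeqModel.hCredibleSet n (α n y) δ (ρ n y) (ε n y) C y ∩
              SeqModel.l2Ball n (α n y) (q n y) y)
          - (1 - γ) ^ 2) := by
  obtain ⟨c, hc, hdata⟩ := SeqModel.exists_eventually_dataLaw_maximizers_le (R := R) hβ
  have hL : Tendsto (fun n : ℕ => Real.log n) atTop atTop :=
    Real.tendsto_log_atTop.comp tendsto_natCast_atTop_atTop
  have key : ∀ η : ℝ, 0 < η → ∀ᶠ n : ℕ in atTop, ∀ y : ℕ → ℝ,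
      (∀ a, 1 ≤ a → (SeqModel.maximizers n a y).Nonempty ∧ SeqModel.maximizers n a y ⊆ Set.Ici c) →
      |(SeqModel.posterior n (α n y) y).real
            (SeqModel.hCredibleSet n (α n y) δ (ρ n y) (ε n y) C y ∩
              SeqModel.l2Ball n (α n y) (q n y) y)
          - (SeqModel.posterior n (α n y) y).real
              (SeqModel.hCredibleSet n (α n y) δ (ρ n y) (ε n y) C y)
            * (SeqModel.posterior n (α n y) y).real
              (SeqModel.l2Ball n (α n y) (q n y) y)| < η ∧
      |(SeqModel.posterior n (α n y) y).real
            (SeqModel.hCredibleSet n (α n y) δ (ρ n y) (ε n y) C y ∩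
              SeqModel.l2Ball n (α n y) (q n y) y)
          - (1 - γ) ^ 2| < η := by
    intro η hη
    have hη4 : 0 < η / 4 := by linarith
    filter_upwards [SeqModel.eventually_abs_posterior_inter_le hδ ha' hη4,
      SeqModel.eventually_posterior_compl_sobolevBall_le hr₁ hC hCr hη4,
      ha.eventually_ge_atTop 1, hL.eventually_gt_atTop 0, hL.eventually_ge_atTop (2 * r₁ / c),
      eventually_ge_atTop 1] with n h1 h2 h3 h4 h5 hn y hgood
    have hαmem := hα n y (hgood _ h3).1
    have hαc : c ≤ α n y := (hgood _ h3).2 hαmem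
    -- The interval for `ε` is non-empty because `log n ≥ 2 r₁ / c` gives `r₁ / log n ≤ c / 2 ≤ α n
    -- y / 2`.
    have hεmem := hε n y ⟨r₁ / Real.log n, le_rfl, by
      rw [div_le_iff₀ hc] at h5
      rw [div_le_div_iff₀ h4 (by norm_num)]
      nlinarith⟩
    have hρmem := hρ n y (SeqModel.hRadii_nonempty hn _ hδ hγ y)
    have hqmem := hq n y (SeqModel.l2Radii_nonempty n (hc.trans_le hαc) hγ y)
    have hI := h1 (α n y) (ρ n y) (q n y) y (hc.le.trans hαc) hαmem.1.2 hρmem.1 hqmem.1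
    have hS := h2 (α n y) (ε n y) y hεmem.1
    set μ := SeqModel.posterior n (α n y) y
    set H := SeqModel.hBall n (α n y) δ (ρ n y) y
    set L := SeqModel.l2Ball n (α n y) (q n y) y
    set B := SeqModel.sobolevBall n (α n y) (α n y - ε n y) (C * √(Real.log n)) y
    have hcred : SeqModel.hCredibleSet n (α n y) δ (ρ n y) (ε n y) C y = H ∩ B := rfl
    -- Dropping the Sobolev constraint costs `η / 4`. It is done for `H ∩ L` and for `H`, and
    -- approximate independence costs another `η / 4`, so the total stays below `η`.
    have hremove : ∀ E : Set (ℕ → ℝ), μ.real (E ∩ B) ≤ μ.real E ∧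
        μ.real E ≤ μ.real (E ∩ B) + η / 4 := by
      intro E
      refine ⟨measureReal_mono Set.inter_subset_left, ?_⟩
      refine (measureReal_mono (s₂ := E ∩ B ∪ Bᶜ) fun f hf => ?_).trans
        ((measureReal_union_le _ _).trans (by linarith))
      by_cases hfB : f ∈ B
      · exact Or.inl ⟨hf, hfB⟩
      · exact Or.inr hfB
    have hHL := hremove (H ∩ L)
    have hH := hremove H
    have e : H ∩ B ∩ L = H ∩ L ∩ B := Set.inter_right_comm H B L
    have hL0 : 0 ≤ μ.real L := measureReal_nonneg
    have hL1 : μ.real L ≤ 1 := measureReal_le_one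
    have hρv : μ.real H = 1 - γ := hρmem.2
    have hqv : μ.real L = 1 - γ := hqmem.2
    have hp1 : μ.real (H ∩ B) * μ.real L ≤ μ.real H * μ.real L :=
      mul_le_mul_of_nonneg_right hH.1 hL0
    have hp2 : μ.real H * μ.real L ≤ μ.real (H ∩ B) * μ.real L + η / 4 := by
      have := mul_le_mul_of_nonneg_right hH.2 hL0
      nlinarith
    rw [abs_le] at hI
    rw [hcred, e]
    constructor
    · rw [abs_lt]
      constructor <;> linarith [hI.1, hI.2, hHL.1, hHL.2]
    · have hsq : (1 - γ) ^ 2 = μ.real H * μ.real L := by rw [hρv, hqv]; ring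
      rw [hsq, abs_lt]
      constructor <;> linarith [hI.1, hI.2, hHL.1, hHL.2]
  constructor
  · refine SeqModel.UniformlyTendsToZeroInProbability.of_eventually fun η hη => ?_
    filter_upwards [key η hη, hdata η hη] with n hk hd f hf
    refine (measure_mono fun y hy hgood => ?_).trans (hd f hf)
    exact absurd (hk y hgood).1 (not_lt.2 hy)
  · refine SeqModel.UniformlyTendsToZeroInProbability.of_eventually fun η hη => ?_
    filter_upwards [key η hη, hdata η hη] with n hk hd f hf
    refine (measure_mono fun y hy hgood => ?_).trans (hd f hf)
    exact absurd (hk y hgood).2 (not_lt.2 hy)
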